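/- Let $\mathcal{E}=\{\pm e_1,\pm e_2\}$ be the set of unit vectors of $\mathbb{Z}^2$, let $\mathcal{P}=M_1(\mathcal{E})$ be the set of probability measures on $\mathcal{E}$ (with the $\sigma$-algebra generated by the evaluation maps), and let $\mu$ be an arbitrary probability measure on $\mathcal{P}$; no ellipticity is assumed, i.e. a $\gamma\in\mathcal{P}$ may give mass $0$ to some of the steps. Let $\Omega=\mathcal{P}^{\mathbb{Z}^2}$ be equipped with the product $\sigma$-algebra and the product measure $\nu=\mu^{\otimes\mathbb{Z}^2}$, so that under $\nu$ the environment $\omega=(\omega_x)_{x\in\mathbb{Z}^2}$ is i.i.d. with law $\mu$. For $\omega\in\Omega$ let $\mathbb{P}_\omega$ be the law of the time-homogeneous Markov chain $(X_n)_{n\ge 0}$ on $\mathbb{Z}^2$ with $X_0=0$ and transition probabilities $p_\omega(x,x+e)=\omega_x(e)$ for $x\in\mathbb{Z}^2$, $e\in\mathcal{E}$, and let $P(\cdot)=\int_\Omega \mathbb{P}_\omega(\cdot)\,d\nu(\omega)$ be the annealed law of the walk. Theorem. For every $\ell\in\mathbb{R}^2\setminus\{0\}$, the event $A_\ell=\{X_n\cdot\ell\to+\infty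 \text{ as } n\to\infty\}$ of transience in direction $\ell$ satisfies $$P(A_\ell)\in\{0,1\}.$$ -/

import Mathlib

open MeasureTheory ProbabilityTheory Filter

namespace RWRE

/-- The set `{± e_i : i = 1, …, d}` of unit vectors of `ℤ^d`. -/
def unitSteps (d : ℕ) : Set (Fin d → ℤ) :=
  {e | ∃ i : Fin d, e = Pi.single i 1 ∨ e = -Pi.single i 1}

/-- The space `M_1(ℰ)` of probability measures on the set of unit vectors of `ℤ^d`, with the
σ-algebra generated by the evaluation maps. -/
abbrev LocalEnv (d : ℕ) : Type := ProbabilityMeasure (unitSteps d)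

/-- An environment attaches to every site of `ℤ^d` a probability measure on the unit vectors. -/
abbrev Env (d : ℕ) : Type := (Fin d → ℤ) → LocalEnv d

/-- The i.i.d. environment law `ν = μ^{⊗ ℤ^d}`. -/
noncomputable def envLaw {d : ℕ} (μ : Measure (LocalEnv d)) : Measure (Env d) :=
  Measure.infinitePi (fun _ : Fin d → ℤ => μ)

/-- The law of the next position `y + e` of the walk when it stands at `y`, where `e` is drawn
from `ω y`. -/
noncomputable def stepLaw {d : ℕ} (ω : Env d) (y : Fin d → ℤ) : Measure (Fin d → ℤ) :=
  (ω y : Measure (unitSteps d)).map (fun e : unitSteps d => y + (e : Fin d → ℤ))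

instance {d : ℕ} (ω : Env d) (y : Fin d → ℤ) : IsProbabilityMeasure (stepLaw ω y) :=
  Measure.isProbabilityMeasure_map (by fun_prop)

/-- The transition kernel of the walk in the environment `ω` at time `n`: it depends on the
trajectory up to time `n` only through the current position. -/
noncomputable def stepKernel {d : ℕ} (ω : Env d) (n : ℕ) :
    Kernel (Π _ : Finset.Iic n, Fin d → ℤ) (Fin d → ℤ) where
  toFun h := stepLaw ω (h ⟨n, Finset.mem_Iic.2 le_rfl⟩)
  measurable' := measurable_of_countable _

instance {d : ℕ} (ω : Env d) (n : ℕ) : IsMarkovKernel (stepKernel ω n) :=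
  ⟨fun _ => inferInstanceAs (IsProbabilityMeasure (stepLaw ω _))⟩

/-- The quenched law `ℙ_{ω,x}` on the space of trajectories `(X_n)_{n ≥ 0}` in `ℤ^d`: the law of
the Markov chain with transition probabilities `p_ω(y, y + e) = ω_y(e)` started at `x`. -/
noncomputable def quenchedLaw {d : ℕ} (x : Fin d → ℤ) (ω : Env d) : Measure (ℕ → Fin d → ℤ) :=
  Kernel.traj (X := fun _ => Fin d → ℤ) (stepKernel ω) 0 (fun _ => x)

instance {d : ℕ} (x : Fin d → ℤ) (ω : Env d) : IsProbabilityMeasure (quenchedLaw x ω) := by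
  unfold quenchedLaw; infer_instance

theorem measurable_stepLaw {d : ℕ} (y : Fin d → ℤ) :
    Measurable (fun ω : Env d => stepLaw ω y) := by
  unfold stepLaw
  exact (Measure.measurable_map _ (by fun_prop)).comp
    (measurable_subtype_coe.comp (measurable_pi_apply y))

theorem measurable_partialTraj {d : ℕ} (x : Fin d → ℤ) (n : ℕ) :
    Measurable (fun ω : Env d =>
      Kernel.partialTraj (X := fun _ => Fin d → ℤ) (stepKernel ω) 0 n (fun _ => x)) := by
  induction n with
  | zero => simp [Kernel.partialTraj_self]
  | succ n ih =>
    refine Measure.measurable_of_measurable_coe _ fun S hS => ?_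
    have key : ∀ ω : Env d,
        Kernel.partialTraj (X := fun _ => Fin d → ℤ) (stepKernel ω) 0 (n + 1) (fun _ => x) S
        = ∑' h : (Π _ : Finset.Iic n, Fin d → ℤ),
          Kernel.partialTraj (X := fun _ => Fin d → ℤ) (stepKernel ω) n (n + 1) h S *
          Kernel.partialTraj (X := fun _ => Fin d → ℤ) (stepKernel ω) 0 n (fun _ => x) {h} := by
      intro ω
      rw [Kernel.partialTraj_succ_eq_comp (Nat.zero_le n), Kernel.comp_apply' _ _ _ hS,
        lintegral_countable']
    simp_rw [key]
    refine Measurable.tsum fun h => Measurable.mul ?_ ?_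
    · have hk : ∀ ω : Env d,
          Kernel.partialTraj (X := fun _ => Fin d → ℤ) (stepKernel ω) n (n + 1) h S
          = stepLaw ω (h ⟨n, Finset.mem_Iic.2 le_rfl⟩)
            ((fun y => IicProdIoc (X := fun _ => Fin d → ℤ) n (n + 1)
              (h, MeasurableEquiv.piSingleton (X := fun _ => Fin d → ℤ) n y)) ⁻¹' S) := by
        intro ω
        rw [Kernel.partialTraj_succ_self, Kernel.map_apply' _ (by fun_prop) _ hS,
          Kernel.prod_apply, Kernel.id_apply, Measure.dirac_prod,
          Kernel.map_apply _ (by fun_prop), Measure.map_map (by fun_prop) (by fun_prop),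
          Measure.map_apply (by fun_prop) (measurable_of_countable _ hS)]
        rfl
      simp_rw [hk]
      exact (Measure.measurable_coe (MeasurableSet.of_discrete)).comp (measurable_stepLaw _)
    · exact (Measure.measurable_coe (measurableSet_singleton h)).comp ih

theorem measurable_quenchedLaw {d : ℕ} (x : Fin d → ℤ) :
    Measurable (quenchedLaw (d := d) x) := by
  refine Measurable.measure_of_isPiSystem_of_isProbabilityMeasure
    (S := measurableCylinders (fun _ : ℕ => Fin d → ℤ))
    generateFrom_measurableCylinders.symm isPiSystem_measurableCylinders fun s hs => ?_
  obtain ⟨n, S, hS, rfl⟩ : ∃ (n : ℕ) (S : Set (Π _ : Finset.Iic n, Fin d → ℤ)),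
      MeasurableSet S ∧ s = Preorder.frestrictLe (π := fun _ : ℕ => Fin d → ℤ) n ⁻¹' S := by
    obtain ⟨I, T, hT, rfl⟩ := (mem_measurableCylinders _).1 hs
    have hI : I ⊆ Finset.Iic (I.sup id) := fun i hi => Finset.mem_Iic.2 (Finset.le_sup (f := id) hi)
    exact ⟨I.sup id, Finset.restrict₂ (π := fun _ : ℕ => Fin d → ℤ) hI ⁻¹' T,
      Finset.measurable_restrict₂ hI hT, rfl⟩
  have key : ∀ ω : Env d, quenchedLaw x ω
      (Preorder.frestrictLe (π := fun _ : ℕ => Fin d → ℤ) n ⁻¹' S) =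
      Kernel.partialTraj (X := fun _ => Fin d → ℤ) (stepKernel ω) 0 n (fun _ => x) S := by
    intro ω
    rw [← Kernel.traj_map_frestrictLe_apply, Measure.map_apply (by fun_prop) hS]
    rfl
  simp_rw [key]
  exact (Measure.measurable_coe hS).comp (measurable_partialTraj x n)

/-- The quenched laws as a Markov kernel from environments to trajectories. -/
noncomputable def quenchedKernel {d : ℕ} (x : Fin d → ℤ) : Kernel (Env d) (ℕ → Fin d → ℤ) where
  toFun := quenchedLaw x
  measurable' := measurable_quenchedLaw x

/-- The annealed law `P_x(A) = ∫ ℙ_{ω,x}(A) ν(dω)` of the random walk in random environment. -/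
noncomputable def annealedLaw {d : ℕ} (μ : Measure (LocalEnv d)) (x : Fin d → ℤ) :
    Measure (ℕ → Fin d → ℤ) :=
  (envLaw μ).bind (quenchedKernel x)

/-- The event `X_n · ℓ → +∞` of transience in the direction `ℓ`. -/
def transientEvent {d : ℕ} (l : Fin d → ℝ) : Set (ℕ → Fin d → ℤ) :=
  {X | Tendsto (fun n => ∑ i, (X n i : ℝ) * l i) atTop atTop}

end RWRE

/-!
The proof consists of two parts.

*Kalikow's part*, valid in every dimension and without ellipticity
(`annealedLaw_transientEvent_neg_ne_zero`): if transience in the direction `l` has a probability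
strictly between `0` and `1`, then transience in the direction `-l` has positive probability. A
transient walk has a positive chance of never going below its starting level, and this can be
used afresh at each record of the level, because the sites beyond a record have not been seen
(`annealedLaw_frequently_inter_eq_zero`). Hence almost surely the walk is transient as soon as its
level is unbounded above (`ae_transient_of_not_bddAbove`). A walk whose level is bounded above
visits only finitely many sites above each level (`ae_finite_of_bddAbove`), so that it attains its
maximal level and does not exceed it afterwards. Thus the walk has a positive chance of never going
above its starting level, and by the same reasoning it tends to `-∞` as soon as its level is
unbounded below. A walk that is bounded in both directions visits only finitely many sites. This
is impossible if every site offers a step into a fixed orthant (`ae_infinite_range`); if there is no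
such orthant, some cube is a trap with positive probability, and then the level is almost surely
bounded above (`ae_bddAbove_of_trap`).

*The planar part* (`annealedLaw_transientEvent_eq_zero_or_neg`): transience in the directions `l`
and `-l` cannot both have positive probability. Let two walks start at `0` and at a distant site `z`
with a large level, and consider the event that they go without backtracking to `+∞` and to `-∞`.

* In a *common* environment they are unlikely to meet: at a site which one of them visits late, its
  transience is nearly certain by Lévy's zero-one law, so that the transience of the other one in
  the opposite direction is nearly impossible (`exists_jointLaw_meet_le`).
* In *independent* environments they meet with a probability bounded away from zero if `z` is
  chosen suitably (`exists_mul_le_prod_meet`). If they do not meet, they pass one another on the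
  same side (`mem_passes_iff_of_disjoint`). As `z` moves in a half-plane from far on one side to far
  on the other, the side on which the first walk passes `z` changes; where both sides have a fair
  probability, independence prevents the two walks from always agreeing on the side, and where the
  probability jumps, the first walk is likely to visit `z`.
* On the event that they do *not* meet, the two situations have the same law, because the walks
  use different sites (`jointLaw_inter_disjointPaths`).

Since the two walks are asymptotically independent also in a common environment
(`exists_mul_le_jointLaw`), these three facts contradict one another. The side on which a walk
passes a site is encoded by a lattice winding number that counts signed crossings of one half of
the boundary line of a half-plane (`crossing`); its homotopy invariance is `crossing_sum_eq`.
-/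

namespace RWRE

/-! ### Trajectories, cylinders and conditional Borel–Cantelli arguments -/

section PathSpace

variable {S : Type*}

/-- The cylinder of all trajectories that agree with `X` up to and including time `n`. -/
def cyl (X : ℕ → S) (n : ℕ) : Set (ℕ → S) := {Y | ∀ i ≤ n, Y i = X i}

/-- The set `s` of trajectories is determined by the trajectory up to and including time `n`. -/
def Det (n : ℕ) (s : Set (ℕ → S)) : Prop := ∀ X Y : ℕ → S, Y ∈ cyl X n → X ∈ s → Y ∈ s

theorem self_mem_cyl (X : ℕ → S) (n : ℕ) : X ∈ cyl X n := fun _ _ => rfl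

theorem cyl_eq_of_mem {X Y : ℕ → S} {n : ℕ} (h : Y ∈ cyl X n) : cyl Y n = cyl X n := by
  ext Z
  exact ⟨fun hZ i hi => (hZ i hi).trans (h i hi), fun hZ i hi => (hZ i hi).trans (h i hi).symm⟩

theorem cyl_anti (X : ℕ → S) {m n : ℕ} (h : m ≤ n) : cyl X n ⊆ cyl X m :=
  fun _ hY i hi => hY i (hi.trans h)

theorem det_cyl (X : ℕ → S) {m n : ℕ} (h : m ≤ n) : Det n (cyl X m) := by
  intro Y Z hZ hY i hi
  rw [hZ i (hi.trans h), hY i hi]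

theorem Det.inter {n : ℕ} {s t : Set (ℕ → S)} (hs : Det n s) (ht : Det n t) : Det n (s ∩ t) :=
  fun X Y h hX => ⟨hs X Y h hX.1, ht X Y h hX.2⟩

theorem Det.mono {m n : ℕ} {s : Set (ℕ → S)} (hs : Det m s) (h : m ≤ n) : Det n s :=
  fun X Y hY hX => hs X Y (cyl_anti X h hY) hX

theorem Det.cyl_subset {n : ℕ} {s : Set (ℕ → S)} (hs : Det n s) {X : ℕ → S} (hX : X ∈ s) :
    cyl X n ⊆ s := fun Y hY => hs X Y hY hX

theorem preimage_restrict_eq_cyl (X : ℕ → S) (n : ℕ) :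
    (fun (Y : ℕ → S) (i : Fin (n + 1)) => Y i) ⁻¹' {fun i : Fin (n + 1) => X i} = cyl X n := by
  ext Y
  simp only [Set.mem_preimage, Set.mem_singleton_iff, cyl, Set.mem_ofPred_eq, funext_iff]
  exact ⟨fun h i hi => h ⟨i, Nat.lt_succ_of_le hi⟩, fun h i => h i (Nat.le_of_lt_succ i.2)⟩

theorem exists_cyl_subset [TopologicalSpace S] {U : Set (ℕ → S)} (hU : IsOpen U) {X : ℕ → S}
    (hX : X ∈ U) : ∃ n, cyl X n ⊆ U := by
  obtain ⟨I, u, hu, hsub⟩ := isOpen_pi_iff.1 hU X hX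
  refine ⟨I.sup id, fun Y hY => hsub fun i hi => ?_⟩
  rw [hY i (Finset.le_sup (f := id) hi)]
  exact (hu i hi).2

variable [Countable S] [MeasurableSpace S] [MeasurableSingletonClass S]

theorem Det.measurableSet {n : ℕ} {s : Set (ℕ → S)} (hs : Det n s) : MeasurableSet s := by
  have : s = (fun (Y : ℕ → S) (i : Fin (n + 1)) => Y i) ⁻¹'
      ((fun (Y : ℕ → S) (i : Fin (n + 1)) => Y i) '' s) := by
    refine Set.Subset.antisymm (Set.subset_preimage_image _ _) ?_
    rintro Y ⟨X, hX, hXY⟩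
    refine hs X Y (fun i hi => ?_) hX
    exact (congrFun hXY ⟨i, Nat.lt_succ_of_le hi⟩).symm
  rw [this]
  exact (by fun_prop : Measurable fun (Y : ℕ → S) (i : Fin (n + 1)) => Y i)
    (Set.to_countable _).measurableSet

theorem measurableSet_cyl (X : ℕ → S) (n : ℕ) : MeasurableSet (cyl X n) :=
  (det_cyl X le_rfl).measurableSet

/-- A bound on all cylinders inside a determined set can be summed up. -/
theorem measure_inter_le_of_cyl {P Q : Measure (ℕ → S)} {n : ℕ} {s B : Set (ℕ → S)}
    {c : ENNReal} (hs : Det n s) (h : ∀ X ∈ s, P (cyl X n ∩ B) ≤ c * Q (cyl X n)) :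
    P (s ∩ B) ≤ c * Q s := by
  set ρ : (ℕ → S) → (Fin (n + 1) → S) := fun Y i => Y i with hρ
  have hρm : Measurable ρ := by fun_prop
  have hcov : s ∩ B ⊆ ⋃ t, (ρ ⁻¹' {t} ∩ s) ∩ B := fun X hX =>
    Set.mem_iUnion.2 ⟨ρ X, ⟨rfl, hX.1⟩, hX.2⟩
  have hQ : Q s = ∑' t, Q (ρ ⁻¹' {t} ∩ s) := by
    rw [← measure_iUnion]
    · congr 1
      ext X
      simp
    · intro t t' htt'
      refine Set.disjoint_left.2 fun X hX hX' => htt' ?_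
      exact (hX.1 : ρ X = t).symm.trans hX'.1
    · intro t
      exact (hρm (measurableSet_singleton t)).inter hs.measurableSet
  calc P (s ∩ B) ≤ P (⋃ t, (ρ ⁻¹' {t} ∩ s) ∩ B) := measure_mono hcov
    _ ≤ ∑' t, P ((ρ ⁻¹' {t} ∩ s) ∩ B) := measure_iUnion_le _
    _ ≤ ∑' t, c * Q (ρ ⁻¹' {t} ∩ s) := by
        refine ENNReal.tsum_le_tsum fun t => ?_
        rcases (ρ ⁻¹' {t} ∩ s).eq_empty_or_nonempty with h0 | ⟨X, hXt, hXs⟩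
        · simp [h0]
        · have hc : ρ ⁻¹' {t} ∩ s = cyl X n := by
            rw [← (hXt : ρ X = t), hρ, preimage_restrict_eq_cyl]
            exact Set.inter_eq_left.2 (hs.cyl_subset hXs)
          rw [hc]
          exact h X hXs
    _ = c * Q s := by rw [ENNReal.tsum_mul_left, hQ]

theorem measure_eq_of_cyl {P Q : Measure (ℕ → S)} {n : ℕ} {s : Set (ℕ → S)}
    (hs : Det n s) (h : ∀ X ∈ s, P (cyl X n) = Q (cyl X n)) : P s = Q s := by
  refine le_antisymm ?_ ?_
  · simpa using measure_inter_le_of_cyl (B := Set.univ) (c := 1) hs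
      (fun X hX => by simpa using (h X hX).le)
  · simpa using measure_inter_le_of_cyl (B := Set.univ) (c := 1) hs
      (fun X hX => by simpa using (h X hX).ge)

/-- If at each `good` time the conditional probability of `B` is at most `c`, then so is the
probability of `B` on the event that a good time occurs: decompose at the first good time. -/
theorem measure_inter_exists_le {P : Measure (ℕ → S)} {B : Set (ℕ → S)}
    {good : ℕ → Set (ℕ → S)} {c : ENNReal} (hgood : ∀ n, Det n (good n))
    (h : ∀ n, ∀ X ∈ good n, P (cyl X n ∩ B) ≤ c * P (cyl X n)) :
    P ((⋃ n, good n) ∩ B) ≤ c * P (⋃ n, good n) := by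
  have hdet : ∀ n, Det n (disjointed good n) := by
    intro n X Y hY hX
    rw [disjointed_apply] at hX ⊢
    refine ⟨hgood n X Y hY hX.1, fun hYs => hX.2 ?_⟩
    simp only [Finset.sup_set_eq_biUnion, Set.mem_iUnion, exists_prop] at hYs ⊢
    obtain ⟨i, hi, hYi⟩ := hYs
    refine ⟨i, hi, hgood i Y X ?_ hYi⟩
    rw [cyl_eq_of_mem (cyl_anti X (Finset.mem_Iio.1 hi).le hY)]
    exact self_mem_cyl X i
  rw [← iUnion_disjointed, Set.iUnion_inter]
  calc P (⋃ n, disjointed good n ∩ B) ≤ ∑' n, P (disjointed good n ∩ B) := measure_iUnion_le _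
    _ ≤ ∑' n, c * P (disjointed good n) :=
        ENNReal.tsum_le_tsum fun n => measure_inter_le_of_cyl (hdet n) fun X hX =>
          h n X (disjointed_subset good n hX)
    _ = c * P (⋃ n, disjointed good n) := by
        rw [ENNReal.tsum_mul_left, measure_iUnion (disjoint_disjointed good)
          fun n => (hdet n).measurableSet]

theorem ext_of_cyl {P Q : Measure (ℕ → S)} [IsFiniteMeasure P]
    (h : ∀ X n, P (cyl X n) = Q (cyl X n)) : P = Q := by
  have hgen : (MeasurableSpace.pi : MeasurableSpace (ℕ → S)) =
      MeasurableSpace.generateFrom {s | ∃ n, Det n s} := by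
    refine le_antisymm ?_ ?_
    · refine iSup_le fun n => ?_
      rintro _ ⟨t, -, rfl⟩
      refine MeasurableSpace.measurableSet_generateFrom ⟨n, fun X Y hY hX => ?_⟩
      rwa [Set.mem_preimage, hY n le_rfl]
    · refine MeasurableSpace.generateFrom_le ?_
      rintro s ⟨n, hs⟩
      exact hs.measurableSet
  refine ext_of_generate_finite _ hgen ?_ ?_ ?_
  · rintro s ⟨m, hs⟩ t ⟨n, ht⟩ -
    exact ⟨max m n, (hs.mono (le_max_left _ _)).inter (ht.mono (le_max_right _ _))⟩
  · rintro s ⟨n, hs⟩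
    exact measure_eq_of_cyl hs fun X _ => h X n
  · exact measure_eq_of_cyl (n := 0) (fun _ _ _ _ => trivial) fun X _ => h X 0

/-- Two laws that agree on the cylinders inside `D n` for each `n` agree on the subsets of the
closed set `⋂ n, D n`. -/
theorem restrict_iInter_eq_of_cyl {P Q : Measure (ℕ → S)} [IsFiniteMeasure P] [IsFiniteMeasure Q]
    {D : ℕ → Set (ℕ → S)} (hD : ∀ n, Det n (D n)) (hanti : Antitone D)
    (h : ∀ n, ∀ X ∈ D n, P (cyl X n) = Q (cyl X n)) :
    P.restrict (⋂ n, D n) = Q.restrict (⋂ n, D n) := by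
  have hDm : ∀ n, MeasurableSet (D n) := fun n => (hD n).measurableSet
  refine ext_of_cyl fun X n => ?_
  have lim : ∀ R : Measure (ℕ → S), IsFiniteMeasure R →
      Tendsto (fun N => R (cyl X n ∩ D N)) atTop (nhds (R.restrict (⋂ n, D n) (cyl X n))) := by
    intro R _
    rw [Measure.restrict_apply (measurableSet_cyl X n), Set.inter_iInter]
    refine tendsto_measure_iInter_atTop
      (fun N => ((measurableSet_cyl X n).inter (hDm N)).nullMeasurableSet) ?_
      ⟨0, measure_ne_top _ _⟩
    exact fun a b hab => Set.inter_subset_inter_right _ (hanti hab)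
  refine tendsto_nhds_unique_of_eventuallyEq (lim P inferInstance) (lim Q inferInstance) ?_
  filter_upwards [eventually_ge_atTop n] with N hN
  exact measure_eq_of_cyl ((det_cyl X hN).inter (hD N)) fun Y hY => h N Y hY.2

section Topology

variable [TopologicalSpace S] [DiscreteTopology S] [BorelSpace S]

/-- A conditional form of the second Borel–Cantelli lemma: if `B` has conditional probability at
most `c < 1` at each good time, then almost surely on `B` there are only finitely many good
times. -/
theorem measure_inter_frequently_eq_zero {P : Measure (ℕ → S)} [IsFiniteMeasure P]
    {B : Set (ℕ → S)} {good : ℕ → Set (ℕ → S)} {c : ENNReal} (hc : c < 1)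
    (hgood : ∀ n, Det n (good n))
    (h : ∀ n, ∀ X ∈ good n, P (cyl X n ∩ B) ≤ c * P (cyl X n)) :
    P ({X | ∃ᶠ n in atTop, X ∈ good n} ∩ B) = 0 := by
  set B' := {X | ∃ᶠ n in atTop, X ∈ good n} ∩ B
  have key : ∀ U, IsOpen U → B' ⊆ U → P B' ≤ c * P U := by
    intro U hU hBU
    -- only those good times are used at which the trajectory is already confined to `U`
    have hdet : ∀ n, Det n (good n ∩ {X | cyl X n ⊆ U}) := fun n =>
      (hgood n).inter fun X Y hY hX => by
        rw [Set.mem_ofPred_eq, cyl_eq_of_mem hY]; exact hX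
    have hsub : (⋃ n, (good n ∩ {X | cyl X n ⊆ U})) ⊆ U :=
      Set.iUnion_subset fun n X hX => hX.2 (self_mem_cyl X n)
    refine le_trans (measure_mono ?_) ((measure_inter_exists_le hdet
      fun n X hX => h n X hX.1).trans (mul_le_mul_right (measure_mono hsub) c))
    intro X hX
    obtain ⟨n, hn⟩ := exists_cyl_subset hU (hBU hX)
    obtain ⟨m, hm, hgm⟩ := (frequently_atTop.1 hX.1) n
    exact ⟨Set.mem_iUnion.2 ⟨m, hgm, (cyl_anti X hm).trans hn⟩, hX.2⟩
  by_contra h0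
  have hlt : P B' < c⁻¹ * P B' := by
    have h1 : 1 < c⁻¹ := ENNReal.one_lt_inv.2 hc
    calc P B' = 1 * P B' := (one_mul _).symm
      _ < c⁻¹ * P B' := (ENNReal.mul_lt_mul_iff_left h0 (measure_ne_top _ _)).2 h1
  obtain ⟨U, hBU, hU, hPU⟩ := Set.exists_isOpen_lt_of_lt B' _ hlt
  have h2 := key U hU hBU
  rcases eq_or_ne c 0 with rfl | hc0
  · simp at h2; exact h0 h2
  have : c * P U < P B' := by
    calc c * P U < c * (c⁻¹ * P B') :=
          (ENNReal.mul_lt_mul_iff_right hc0 hc.ne_top).2 hPU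
      _ = P B' := by rw [← mul_assoc, ENNReal.mul_inv_cancel hc0 hc.ne_top, one_mul]
  exact absurd h2 this.not_ge

end Topology

end PathSpace

/-- An event is approximated by an event that is determined by finitely many steps: cylinders are
a basis of the topology, so that outer regularity applies. -/
theorem exists_det_approx {S : Type*} [Countable S] [MeasurableSpace S] [TopologicalSpace S]
    [DiscreteTopology S] [BorelSpace S] (P : Measure (ℕ → S)) [IsFiniteMeasure P] {B : Set (ℕ → S)}
    (hB : MeasurableSet B) {ε : ENNReal} (hε : ε ≠ 0) :
    ∃ n K, Det n K ∧ P (K \ B) ≤ ε ∧ P B ≤ P K + ε := by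
  obtain ⟨U, hBU, hU, hPU⟩ := hB.exists_isOpen_sdiff_lt (measure_ne_top P B) hε
  have hdet : ∀ n, Det n {X | cyl X n ⊆ U} := fun n X Y hY hX => by
    rw [Set.mem_ofPred_eq, cyl_eq_of_mem hY]; exact hX
  have hUn : (⋃ n, {X | cyl X n ⊆ U}) = U := by
    refine Set.Subset.antisymm (Set.iUnion_subset fun n X hX => hX (self_mem_cyl X n)) ?_
    exact fun X hX => Set.mem_iUnion.2 (exists_cyl_subset hU hX)
  have hmono : Monotone fun n => {X | cyl X n ⊆ U} := fun m n hmn X hX => (cyl_anti X hmn).trans hX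
  have hlim : Tendsto (fun n => P {X | cyl X n ⊆ U} + ε) atTop (nhds (P U + ε)) := by
    refine Tendsto.add_const ε ?_
    have := tendsto_measure_iUnion_atTop (μ := P) hmono
    rwa [hUn] at this
  have hlt : P U < P U + ε := ENNReal.lt_add_right (measure_ne_top _ _) hε
  obtain ⟨n, hn⟩ := (hlim.eventually (lt_mem_nhds hlt)).exists
  refine ⟨n, _, hdet n, (measure_mono ?_).trans hPU.2.le, (measure_mono hBU).trans hn.le⟩
  exact Set.sdiff_subset_sdiff_left fun X hX => hX (self_mem_cyl X n)

/-! ### The quenched law on cylinders and the Markov property -/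

section Quenched

variable {d : ℕ}

theorem cyl_eq_preimage_frestrictLe (X : ℕ → Fin d → ℤ) (n : ℕ) :
    cyl X n = Preorder.frestrictLe (π := fun _ : ℕ => Fin d → ℤ) n ⁻¹'
      {Preorder.frestrictLe (π := fun _ : ℕ => Fin d → ℤ) n X} := by
  ext Y
  simp only [cyl, Set.mem_ofPred_eq, Set.mem_preimage, Set.mem_singleton_iff, funext_iff,
    Preorder.frestrictLe_apply, Subtype.forall, Finset.mem_Iic]

theorem quenchedLaw_cyl_eq_partialTraj (x : Fin d → ℤ) (ω : Env d) (X : ℕ → Fin d → ℤ) (n : ℕ) :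
    quenchedLaw x ω (cyl X n) =
      Kernel.partialTraj (X := fun _ => Fin d → ℤ) (stepKernel ω) 0 n (fun _ => x)
        {Preorder.frestrictLe (π := fun _ : ℕ => Fin d → ℤ) n X} := by
  rw [cyl_eq_preimage_frestrictLe, ← Kernel.traj_map_frestrictLe_apply,
    Measure.map_apply (by fun_prop) (measurableSet_singleton _)]
  rfl

theorem partialTraj_succ_singleton (ω : Env d) (X : ℕ → Fin d → ℤ) (n : ℕ)
    (h : Π _ : Finset.Iic n, Fin d → ℤ) :
    Kernel.partialTraj (X := fun _ => Fin d → ℤ) (stepKernel ω) n (n + 1) h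
        {Preorder.frestrictLe (π := fun _ : ℕ => Fin d → ℤ) (n + 1) X} =
      Set.indicator {Preorder.frestrictLe (π := fun _ : ℕ => Fin d → ℤ) n X}
        (fun _ => stepLaw ω (X n) {X (n + 1)}) h := by
  rw [Kernel.partialTraj_succ_self, Kernel.map_apply' _ (by fun_prop) _ (measurableSet_singleton _),
    Kernel.prod_apply, Kernel.id_apply, Measure.dirac_prod,
    Kernel.map_apply _ (by fun_prop), Measure.map_map (by fun_prop) (by fun_prop),
    Measure.map_apply (by fun_prop) (Set.to_countable _).measurableSet]
  change stepLaw ω (h ⟨n, _⟩) _ = _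
  have key : ∀ y, IicProdIoc (X := fun _ => Fin d → ℤ) n (n + 1)
      (h, MeasurableEquiv.piSingleton (X := fun _ => Fin d → ℤ) n y) =
        Preorder.frestrictLe (π := fun _ : ℕ => Fin d → ℤ) (n + 1) X ↔
      h = Preorder.frestrictLe (π := fun _ : ℕ => Fin d → ℤ) n X ∧ y = X (n + 1) := by
    intro y
    constructor
    · intro hy
      refine ⟨?_, ?_⟩
      · ext1 ⟨i, hi⟩
        have := congrFun hy ⟨i, Finset.mem_Iic.2 ((Finset.mem_Iic.1 hi).trans n.le_succ)⟩
        simpa [IicProdIoc, Finset.mem_Iic.1 hi] using this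
      · have := congrFun hy ⟨n + 1, Finset.mem_Iic.2 le_rfl⟩
        simpa [IicProdIoc, MeasurableEquiv.piSingleton] using this
    · rintro ⟨rfl, rfl⟩
      ext1 ⟨i, hi⟩
      by_cases hin : i ≤ n
      · simp [IicProdIoc, hin]
      · obtain rfl : i = n + 1 := by have := Finset.mem_Iic.1 hi; omega
        simp [IicProdIoc, MeasurableEquiv.piSingleton]
  by_cases hh : h = Preorder.frestrictLe (π := fun _ : ℕ => Fin d → ℤ) n X
  · rw [Set.indicator_of_mem (by exact hh)]
    have : h ⟨n, Finset.mem_Iic.2 le_rfl⟩ = X n := by rw [hh]; rfl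
    rw [this]
    congr 1
    ext y
    simpa [hh] using key y
  · rw [Set.indicator_of_notMem (by exact hh)]
    convert measure_empty (μ := stepLaw ω (h ⟨n, Finset.mem_Iic.2 le_rfl⟩))
    ext y
    simpa [hh] using key y

theorem quenchedLaw_cyl_succ (x : Fin d → ℤ) (ω : Env d) (X : ℕ → Fin d → ℤ) (n : ℕ) :
    quenchedLaw x ω (cyl X (n + 1)) =
      quenchedLaw x ω (cyl X n) * stepLaw ω (X n) {X (n + 1)} := by
  rw [quenchedLaw_cyl_eq_partialTraj, quenchedLaw_cyl_eq_partialTraj,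
    Kernel.partialTraj_succ_eq_comp (Nat.zero_le n),
    Kernel.comp_apply' _ _ _ (measurableSet_singleton _)]
  simp_rw [partialTraj_succ_singleton]
  rw [lintegral_indicator (measurableSet_singleton _), lintegral_const,
    Measure.restrict_apply_univ, mul_comm]

theorem quenchedLaw_cyl_zero (x : Fin d → ℤ) (ω : Env d) (X : ℕ → Fin d → ℤ) :
    quenchedLaw x ω (cyl X 0) = if X 0 = x then 1 else 0 := by
  rw [quenchedLaw_cyl_eq_partialTraj, Kernel.partialTraj_self, Kernel.id_apply,
    Measure.dirac_apply' _ (measurableSet_singleton _), Set.indicator_apply]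
  congr 1
  rw [Set.mem_singleton_iff, funext_iff]
  refine propext ⟨fun h => (h ⟨0, Finset.mem_Iic.2 le_rfl⟩).symm, ?_⟩
  rintro h ⟨i, hi⟩
  obtain rfl : i = 0 := by simpa using hi
  exact h.symm

theorem quenchedLaw_cyl (x : Fin d → ℤ) (ω : Env d) (X : ℕ → Fin d → ℤ) (n : ℕ) :
    quenchedLaw x ω (cyl X n) =
      if X 0 = x then ∏ i ∈ Finset.range n, stepLaw ω (X i) {X (i + 1)} else 0 := by
  induction n with
  | zero => simp [quenchedLaw_cyl_zero]
  | succ n ih => rw [quenchedLaw_cyl_succ, ih, Finset.prod_range_succ]; split_ifs <;> simp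

end Quenched

section Quenched

variable {d : ℕ}

theorem measurable_shift (n : ℕ) :
    Measurable fun (Y : ℕ → Fin d → ℤ) (k : ℕ) => Y (n + k) := by
  fun_prop

/-- The Markov property of the quenched walk, on the event that its first `n` steps are known. -/
theorem quenchedLaw_cyl_inter_shift (x : Fin d → ℤ) (ω : Env d) (X : ℕ → Fin d → ℤ) (n : ℕ)
    {s : Set (ℕ → Fin d → ℤ)} (hs : MeasurableSet s) :
    quenchedLaw x ω (cyl X n ∩ (fun Y k => Y (n + k)) ⁻¹' s) =
      quenchedLaw x ω (cyl X n) * quenchedLaw (X n) ω s := by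
  have key : ((quenchedLaw x ω).restrict (cyl X n)).map (fun Y k => Y (n + k)) =
      quenchedLaw x ω (cyl X n) • quenchedLaw (X n) ω := by
    refine ext_of_cyl fun Z m => ?_
    rw [Measure.map_apply (measurable_shift n) (measurableSet_cyl Z m),
      Measure.restrict_apply (measurable_shift n (measurableSet_cyl Z m)), Measure.smul_apply,
      smul_eq_mul]
    by_cases hZ : Z 0 = X n
    · set W : ℕ → Fin d → ℤ := fun i => if i ≤ n then X i else Z (i - n) with hW
      have hW1 : ∀ i ≤ n, W i = X i := fun i hi => by simp [hW, hi]
      have hW2 : ∀ i, W (n + i) = Z i := by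
        intro i
        rcases Nat.eq_zero_or_pos i with rfl | hi
        · simp [hW, hZ]
        · have : ¬ n + i ≤ n := by omega
          simp only [hW, this, if_false]
          congr 1
          omega
      have h1 : ((fun (Y : ℕ → Fin d → ℤ) k => Y (n + k)) ⁻¹' cyl Z m) ∩ cyl X n =
          cyl W (n + m) := by
        ext Y
        constructor
        · rintro ⟨hY1, hY2⟩ i hi
          by_cases hin : i ≤ n
          · rw [hW1 i hin, hY2 i hin]
          · obtain ⟨j, rfl⟩ := Nat.exists_eq_add_of_le (not_le.1 hin).le
            rw [hW2 j]
            exact hY1 j (by omega)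
        · intro hY
          refine ⟨fun j hj => ?_, fun i hi => ?_⟩
          · rw [← hW2 j]
            exact hY (n + j) (by omega)
          · rw [← hW1 i hi]
            exact hY i (by omega)
      have hcyl : cyl W n = cyl X n := cyl_eq_of_mem hW1
      rw [h1]
      clear h1
      induction m with
      | zero => rw [Nat.add_zero, hcyl, quenchedLaw_cyl_zero, if_pos hZ, mul_one]
      | succ m ih =>
        rw [← Nat.add_assoc, quenchedLaw_cyl_succ, ih, quenchedLaw_cyl_succ, Nat.add_assoc, hW2,
          hW2, mul_assoc]
    · have h1 : ((fun (Y : ℕ → Fin d → ℤ) k => Y (n + k)) ⁻¹' cyl Z m) ∩ cyl X n = ∅ := by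
        refine Set.eq_empty_of_forall_notMem fun Y hY => hZ ?_
        rw [← hY.2 n le_rfl, ← hY.1 0 (Nat.zero_le _)]
        rfl
      rw [h1, measure_empty, quenchedLaw_cyl (X n), if_neg hZ, mul_zero]
  have := congrArg (fun R => R s) key
  simp only [Measure.map_apply (measurable_shift n) hs,
    Measure.restrict_apply (measurable_shift n hs), Measure.smul_apply, smul_eq_mul] at this
  rw [Set.inter_comm]
  exact this

theorem stepLaw_singleton_add (ω : Env d) (y : Fin d → ℤ) (e : unitSteps d) :
    stepLaw ω y {y + (e : Fin d → ℤ)} = (ω y : Measure (unitSteps d)) {e} := by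
  unfold stepLaw
  rw [Measure.map_apply (by fun_prop) (measurableSet_singleton _)]
  congr 1
  ext f
  simp [Subtype.ext_iff]

theorem sub_mem_unitSteps_of_stepLaw_ne_zero {ω : Env d} {y z : Fin d → ℤ}
    (h : stepLaw ω y {z} ≠ 0) : z - y ∈ unitSteps d := by
  by_contra hz
  refine h ?_
  unfold stepLaw
  rw [Measure.map_apply (by fun_prop) (measurableSet_singleton _)]
  convert measure_empty (μ := (ω y : Measure (unitSteps d)))
  refine Set.eq_empty_of_forall_notMem fun e he => hz ?_
  rw [← (show y + (e : Fin d → ℤ) = z from he), add_sub_cancel_left]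
  exact e.2

/-- Almost surely the quenched walk uses only steps of positive probability. -/
theorem ae_quenchedLaw_stepLaw_ne_zero (x : Fin d → ℤ) (ω : Env d) :
    ∀ᵐ X ∂quenchedLaw x ω, X 0 = x ∧ ∀ n, stepLaw ω (X n) {X (n + 1)} ≠ 0 := by
  rw [eventually_and, eventually_countable_forall]
  refine ⟨?_, fun n => ?_⟩
  · have hdet : Det 0 {X : ℕ → Fin d → ℤ | X 0 ≠ x} := fun X Y hY hX => by
      rw [Set.mem_ofPred_eq, hY 0 le_rfl]; exact hX
    have := measure_inter_le_of_cyl (P := quenchedLaw x ω) (Q := quenchedLaw x ω)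
      (B := Set.univ) (c := 0) hdet fun X hX => by
        rw [Set.inter_univ, quenchedLaw_cyl_zero, if_neg hX, zero_mul]
    simpa [ae_iff] using this
  · have hdet : Det (n + 1) {X : ℕ → Fin d → ℤ | stepLaw ω (X n) {X (n + 1)} = 0} :=
      fun X Y hY hX => by
        rw [Set.mem_ofPred_eq, hY n n.le_succ, hY (n + 1) le_rfl]; exact hX
    have := measure_inter_le_of_cyl (P := quenchedLaw x ω) (Q := quenchedLaw x ω)
      (B := Set.univ) (c := 0) hdet fun X hX => by
        rw [Set.inter_univ, quenchedLaw_cyl_succ, (show stepLaw ω (X n) {X (n + 1)} = 0 from hX),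
          mul_zero, zero_mul]
    simpa [ae_iff] using this

/-- As long as the quenched walk stays in `T`, it only sees the environment in `T`. -/
theorem quenchedLaw_eq_of_eqOn {T : Set (Fin d → ℤ)} {ω ω' : Env d} (h : Set.EqOn ω ω' T)
    (x : Fin d → ℤ) {s : Set (ℕ → Fin d → ℤ)} (hs : MeasurableSet s)
    (hsT : ∀ X ∈ s, ∀ n, X n ∈ T) : quenchedLaw x ω s = quenchedLaw x ω' s := by
  have hD : ∀ n, Det n {X : ℕ → Fin d → ℤ | ∀ k ≤ n, X k ∈ T} := fun n X Y hY hX k hk => by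
    rw [hY k hk]; exact hX k hk
  have key := restrict_iInter_eq_of_cyl (P := quenchedLaw x ω) (Q := quenchedLaw x ω') hD
    (fun m n hmn X hX k hk => hX k (hk.trans hmn)) fun n X hX => by
      rw [quenchedLaw_cyl, quenchedLaw_cyl]
      congr 1
      refine Finset.prod_congr rfl fun i hi => ?_
      unfold stepLaw
      rw [h (hX i (Finset.mem_range.1 hi).le)]
  have hsub : s ⊆ ⋂ n, {X : ℕ → Fin d → ℤ | ∀ k ≤ n, X k ∈ T} := fun X hX =>
    Set.mem_iInter.2 fun n k _ => hsT X hX k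
  have := congrArg (fun R => R s) key
  simpa only [Measure.restrict_apply hs, Set.inter_eq_left.2 hsub] using this

/-- Translation covariance: the walk from `x + z` is the translate of the walk from `x` in the
translated environment. -/
theorem quenchedLaw_add (x z : Fin d → ℤ) (ω : Env d) :
    quenchedLaw (x + z) ω = (quenchedLaw x fun y => ω (y + z)).map fun Y k => Y k + z := by
  refine ext_of_cyl fun X n => ?_
  have hm : Measurable fun (Y : ℕ → Fin d → ℤ) k => Y k + z := by fun_prop
  rw [Measure.map_apply hm (measurableSet_cyl X n)]
  have : (fun (Y : ℕ → Fin d → ℤ) k => Y k + z) ⁻¹' cyl X n = cyl (fun k => X k - z) n := by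
    ext Y
    simp only [cyl, Set.mem_preimage, Set.mem_ofPred_eq, eq_sub_iff_add_eq]
  rw [this, quenchedLaw_cyl, quenchedLaw_cyl]
  simp only [sub_eq_iff_eq_add]
  congr 1
  refine Finset.prod_congr rfl fun i _ => ?_
  unfold stepLaw
  rw [Measure.map_apply (by fun_prop) (measurableSet_singleton _),
    Measure.map_apply (by fun_prop) (measurableSet_singleton _)]
  simp only [sub_add_cancel]
  congr 1
  ext e
  simp only [Set.mem_preimage, Set.mem_singleton_iff]
  rw [eq_sub_iff_add_eq, add_right_comm, sub_add_cancel]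

end Quenched

/-! ### The annealed law -/

section Annealed

variable {d : ℕ} {μ : Measure (LocalEnv d)}

theorem annealedLaw_apply (x : Fin d → ℤ) {s : Set (ℕ → Fin d → ℤ)} (hs : MeasurableSet s) :
    annealedLaw μ x s = ∫⁻ ω, quenchedLaw x ω s ∂envLaw μ :=
  Measure.bind_apply hs (quenchedKernel x).measurable.aemeasurable

theorem measurable_quenchedLaw_apply (x : Fin d → ℤ) {s : Set (ℕ → Fin d → ℤ)}
    (hs : MeasurableSet s) : Measurable fun ω => quenchedLaw x ω s :=
  (Measure.measurable_coe hs).comp (measurable_quenchedLaw x)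

theorem annealedLaw_eq_zero_iff (x : Fin d → ℤ) {s : Set (ℕ → Fin d → ℤ)} (hs : MeasurableSet s) :
    annealedLaw μ x s = 0 ↔ ∀ᵐ ω ∂envLaw μ, quenchedLaw x ω s = 0 := by
  rw [annealedLaw_apply x hs, lintegral_eq_zero_iff (measurable_quenchedLaw_apply x hs)]
  rfl

/-- An event that is null from every starting point does not occur at a later time either. -/
theorem annealedLaw_exists_shift_mem_eq_zero (x : Fin d → ℤ)
    {s : (Fin d → ℤ) → Set (ℕ → Fin d → ℤ)} (hs : ∀ y, MeasurableSet (s y))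
    (h : ∀ y, annealedLaw μ y (s y) = 0) :
    annealedLaw μ x {X | ∃ n, (fun k => X (n + k)) ∈ s (X n)} = 0 := by
  have hset : {X : ℕ → Fin d → ℤ | ∃ n, (fun k => X (n + k)) ∈ s (X n)} =
      ⋃ n, ⋃ y, (fun X => X n) ⁻¹' {y} ∩ (fun X k => X (n + k)) ⁻¹' s y := by
    ext X
    simp
  rw [hset, measure_iUnion_null_iff]
  intro n
  rw [measure_iUnion_null_iff]
  intro y
  have hdet : Det n ((fun X : ℕ → Fin d → ℤ => X n) ⁻¹' {y}) := fun X Y hY hX => by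
    rw [Set.mem_preimage, hY n le_rfl]; exact hX
  have := measure_inter_le_of_cyl (P := annealedLaw μ x) (Q := annealedLaw μ x) (c := 0)
    (B := (fun X k => X (n + k)) ⁻¹' s y) hdet fun X hX => by
      obtain rfl : X n = y := hX
      rw [zero_mul, nonpos_iff_eq_zero, annealedLaw_eq_zero_iff _
        ((measurableSet_cyl X n).inter (measurable_shift n (hs _)))]
      filter_upwards [(annealedLaw_eq_zero_iff _ (hs _)).1 (h (X n))] with ω hω
      rw [quenchedLaw_cyl_inter_shift _ _ _ _ (hs _), hω, mul_zero]
  simpa using this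

theorem ae_annealedLaw {x : Fin d → ℤ} {p : (ℕ → Fin d → ℤ) → Prop}
    (hp : MeasurableSet {X | p X}) (h : ∀ᵐ ω ∂envLaw μ, ∀ᵐ X ∂quenchedLaw x ω, p X) :
    ∀ᵐ X ∂annealedLaw μ x, p X := by
  rw [ae_iff]
  refine (annealedLaw_eq_zero_iff x hp.compl).2 ?_
  filter_upwards [h] with ω hω
  exact hω

theorem ae_annealedLaw_steps (x : Fin d → ℤ) :
    ∀ᵐ X ∂annealedLaw μ x, X 0 = x ∧ ∀ n, X (n + 1) - X n ∈ unitSteps d := by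
  refine ae_annealedLaw ?_ (ae_of_all _ fun ω => ?_)
  · have h1 : MeasurableSet {X : ℕ → Fin d → ℤ | X 0 = x} :=
      (by fun_prop : Measurable fun X : ℕ → Fin d → ℤ => X 0) (measurableSet_singleton x)
    have h2 : ∀ n, MeasurableSet {X : ℕ → Fin d → ℤ | X (n + 1) - X n ∈ unitSteps d} := fun n =>
      (by fun_prop : Measurable fun X : ℕ → Fin d → ℤ => X (n + 1) - X n)
        (Set.to_countable _).measurableSet
    convert h1.inter (MeasurableSet.iInter h2) using 1
    ext X
    simp
  · filter_upwards [ae_quenchedLaw_stepLaw_ne_zero x ω] with X hX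
    exact ⟨hX.1, fun n => sub_mem_unitSteps_of_stepLaw_ne_zero (hX.2 n)⟩

variable [IsProbabilityMeasure μ]

instance : IsProbabilityMeasure (envLaw μ) := by
  unfold envLaw; infer_instance

instance (x : Fin d → ℤ) : IsMarkovKernel (quenchedKernel (d := d) x) :=
  ⟨fun ω => inferInstanceAs (IsProbabilityMeasure (quenchedLaw x ω))⟩

instance (x : Fin d → ℤ) : IsProbabilityMeasure (annealedLaw μ x) := by
  unfold annealedLaw; infer_instance

theorem envLaw_map_shift (z : Fin d → ℤ) :
    (envLaw μ).map (fun ω y => ω (y + z)) = envLaw μ := by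
  refine Measure.eq_infinitePi _ fun s t ht => ?_
  have hm : Measurable fun (ω : Env d) y => ω (y + z) := by fun_prop
  rw [Measure.map_apply hm (MeasurableSet.pi s.countable_toSet fun i _ => ht i)]
  have : (fun (ω : Env d) y => ω (y + z)) ⁻¹' (Set.pi s t) =
      Set.pi (s.map (addRightEmbedding z)) fun i => t (i - z) := by
    ext ω
    simp only [Set.mem_preimage, Set.mem_pi, Finset.coe_map, Set.mem_image,
      addRightEmbedding_apply, forall_exists_index, and_imp, forall_apply_eq_imp_iff₂,
      add_sub_cancel_right]
  rw [this, envLaw, Measure.infinitePi_pi _ fun i _ => ht _, Finset.prod_map]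
  simp

theorem lintegral_envLaw_shift (z : Fin d → ℤ) {f : Env d → ENNReal} (hf : Measurable f) :
    ∫⁻ ω, f (fun y => ω (y + z)) ∂envLaw μ = ∫⁻ ω, f ω ∂envLaw μ := by
  have hm : Measurable fun (ω : Env d) y => ω (y + z) := by fun_prop
  conv_rhs => rw [← envLaw_map_shift z]
  rw [lintegral_map hf hm]

theorem annealedLaw_add (x z : Fin d → ℤ) :
    annealedLaw μ (x + z) = (annealedLaw μ x).map fun Y k => Y k + z := by
  have hm : Measurable fun (Y : ℕ → Fin d → ℤ) k => Y k + z := by fun_prop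
  ext s hs
  rw [Measure.map_apply hm hs, annealedLaw_apply _ hs, annealedLaw_apply _ (hm hs),
    ← lintegral_envLaw_shift z (measurable_quenchedLaw_apply x (hm hs))]
  refine lintegral_congr fun ω => ?_
  rw [quenchedLaw_add, Measure.map_apply hm hs]

/-- Functionals of the environment that look at disjoint sets of sites are independent. -/
theorem lintegral_mul_of_dependsOn {f g : Env d → ENNReal} (hf : Measurable f) (hg : Measurable g)
    {T T' : Set (Fin d → ℤ)} (hTT' : Disjoint T T') (hfT : DependsOn f T) (hgT : DependsOn g T') :
    ∫⁻ ω, f ω * g ω ∂envLaw μ = (∫⁻ ω, f ω ∂envLaw μ) * ∫⁻ ω, g ω ∂envLaw μ := by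
  classical
  obtain ⟨ω₀⟩ : Nonempty (Env d) := nonempty_of_isProbabilityMeasure (envLaw μ)
  let m : (Fin d → ℤ) → MeasurableSpace (Env d) := fun y =>
    MeasurableSpace.comap (fun ω => ω y) inferInstance
  have hm : ∀ y, m y ≤ MeasurableSpace.pi := fun y => (measurable_pi_apply y).comap_le
  have hind : iIndep m (envLaw μ) :=
    (iIndepFun_infinitePi (P := fun _ : Fin d → ℤ => μ) (X := fun _ γ => γ)
      fun _ => measurable_id).iIndep
  have meas : ∀ (T : Set (Fin d → ℤ)) (h : Env d → ENNReal), Measurable h → DependsOn h T →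
      Measurable[⨆ y ∈ T, m y] h := by
    intro T h hh hT
    have heq : h = h ∘ fun ω y => if y ∈ T then ω y else ω₀ y := by
      funext ω
      exact hT fun y hy => by simp [hy]
    rw [heq]
    refine hh.comp (@measurable_pi_lambda _ _ _ (⨆ y ∈ T, m y) _ _ fun y => ?_)
    by_cases hy : y ∈ T
    · simp only [hy, if_true]
      exact (comap_measurable (fun ω : Env d => ω y)).mono (le_iSup₂_of_le y hy le_rfl) le_rfl
    · simp only [hy, if_false]
      exact @measurable_const _ _ _ (⨆ y ∈ T, m y) _
  exact lintegral_mul_eq_lintegral_mul_lintegral_of_independent_measurableSpace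
    (iSup₂_le fun y _ => hm y) (iSup₂_le fun y _ => hm y)
    (indep_iSup_of_disjoint hm hind hTT') (meas T f hf hfT) (meas T' g hg hgT)

theorem dependsOn_quenchedLaw_cyl (x : Fin d → ℤ) (X : ℕ → Fin d → ℤ) (n : ℕ) :
    DependsOn (fun ω => quenchedLaw x ω (cyl X n)) (X '' Set.Iio n) := by
  intro ω ω' h
  simp only [quenchedLaw_cyl]
  congr 1
  refine Finset.prod_congr rfl fun i hi => ?_
  unfold stepLaw
  rw [h (X i) ⟨i, Finset.mem_range.1 hi, rfl⟩]

/-- Renewal: given the first `n` steps, the walk behaves like a fresh one as far as events are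
concerned that only look at sites not visited before. -/
theorem annealedLaw_cyl_inter_shift (x : Fin d → ℤ) (X : ℕ → Fin d → ℤ) (n : ℕ)
    {s : Set (ℕ → Fin d → ℤ)} (hs : MeasurableSet s) {T : Set (Fin d → ℤ)}
    (hT : DependsOn (fun ω => quenchedLaw (X n) ω s) T) (hX : ∀ i < n, X i ∉ T) :
    annealedLaw μ x (cyl X n ∩ (fun Y k => Y (n + k)) ⁻¹' s) =
      annealedLaw μ x (cyl X n) * annealedLaw μ (X n) s := by
  rw [annealedLaw_apply _ ((measurableSet_cyl X n).inter (measurable_shift n hs)),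
    annealedLaw_apply _ (measurableSet_cyl X n), annealedLaw_apply _ hs]
  simp_rw [quenchedLaw_cyl_inter_shift x _ X n hs]
  refine lintegral_mul_of_dependsOn (measurable_quenchedLaw_apply x (measurableSet_cyl X n))
    (measurable_quenchedLaw_apply _ hs) ?_ (dependsOn_quenchedLaw_cyl x X n) hT
  rw [Set.disjoint_left]
  rintro _ ⟨i, hi, rfl⟩
  exact hX i hi

end Annealed

/-! ### Levels and transience -/

section Level

variable {d : ℕ}

/-- The level `x · l` of the site `x` in the direction `l`. -/
noncomputable def lev (l : Fin d → ℝ) (x : Fin d → ℤ) : ℝ := ∑ i, (x i : ℝ) * l i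

@[simp] theorem lev_zero (l : Fin d → ℝ) : lev l 0 = 0 := by simp [lev]

theorem lev_add (l : Fin d → ℝ) (x y : Fin d → ℤ) : lev l (x + y) = lev l x + lev l y := by
  simp [lev, add_mul, Finset.sum_add_distrib]

theorem lev_sub (l : Fin d → ℝ) (x y : Fin d → ℤ) : lev l (x - y) = lev l x - lev l y := by
  simp [lev, sub_mul, Finset.sum_sub_distrib]

theorem lev_neg_left (l : Fin d → ℝ) (x : Fin d → ℤ) : lev (-l) x = -lev l x := by
  simp [lev]

theorem lev_single (l : Fin d → ℝ) (i : Fin d) (a : ℤ) : lev l (Pi.single i a) = a * l i := by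
  unfold lev
  rw [Finset.sum_eq_single i] <;> simp +contextual

theorem mem_transientEvent {l : Fin d → ℝ} {X : ℕ → Fin d → ℤ} :
    X ∈ transientEvent l ↔ Tendsto (fun n => lev l (X n)) atTop atTop := Iff.rfl

theorem measurable_lev_comp (l : Fin d → ℝ) (n : ℕ) :
    Measurable fun X : ℕ → Fin d → ℤ => lev l (X n) :=
  (measurable_of_countable (lev l)).comp (measurable_pi_apply n)

theorem measurableSet_transientEvent (l : Fin d → ℝ) : MeasurableSet (transientEvent l) :=
  measurableSet_tendsto atTop fun n => measurable_lev_comp l n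

theorem measurableSet_forall_lev (l : Fin d → ℝ) (u : ℝ) :
    MeasurableSet {X : ℕ → Fin d → ℤ | ∀ n, u ≤ lev l (X n)} := by
  rw [Set.ofPred_forall]
  exact MeasurableSet.iInter fun n => measurableSet_le measurable_const (measurable_lev_comp l n)

theorem measurableSet_forall_mem (A : Set (Fin d → ℤ)) :
    MeasurableSet {X : ℕ → Fin d → ℤ | ∀ n, X n ∈ A} := by
  rw [Set.ofPred_forall]
  exact MeasurableSet.iInter fun n => measurable_pi_apply n (Set.to_countable A).measurableSet

theorem transientEvent_shift {l : Fin d → ℝ} {X : ℕ → Fin d → ℤ} (n : ℕ) :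
    (fun k => X (n + k)) ∈ transientEvent l ↔ X ∈ transientEvent l := by
  simp only [mem_transientEvent]
  simp_rw [add_comm n]
  exact tendsto_add_atTop_iff_nat (f := fun k => lev l (X k)) n

theorem transientEvent_add {l : Fin d → ℝ} {X : ℕ → Fin d → ℤ} (z : Fin d → ℤ) :
    (fun k => X k + z) ∈ transientEvent l ↔ X ∈ transientEvent l := by
  simp only [mem_transientEvent, lev_add]
  constructor
  · intro h
    simpa using tendsto_atTop_add_const_right _ (-lev l z) h
  · exact tendsto_atTop_add_const_right _ (lev l z)

/-- A sequence that is unbounded above attains new maxima infinitely often, at arbitrary height. -/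
theorem frequently_record {a : ℕ → ℝ} (ha : ¬ BddAbove (Set.range a)) (u : ℝ) :
    ∃ᶠ n in atTop, (∀ i < n, a i < a n) ∧ u ≤ a n := by
  classical
  rw [frequently_atTop]
  intro N
  obtain ⟨M, hM⟩ := ((Set.finite_Iio N).image a).bddAbove
  have hex : ∃ n, max M u < a n := by
    by_contra! h
    exact ha ⟨max M u, by rintro _ ⟨n, rfl⟩; exact h n⟩
  refine ⟨Nat.find hex, ?_, fun i hi => ?_, ((le_max_right _ _).trans_lt (Nat.find_spec hex)).le⟩
  · by_contra! h
    exact absurd (hM ⟨_, h, rfl⟩) (not_le.2 ((le_max_left _ _).trans_lt (Nat.find_spec hex)))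
  · exact (not_lt.1 (Nat.find_min hex hi)).trans_lt (Nat.find_spec hex)

end Level

/-! ### Renewal on fresh sites -/

section Renewal

variable {d : ℕ} {μ : Measure (LocalEnv d)} [IsProbabilityMeasure μ]

theorem annealedLaw_sub_mem (x : Fin d → ℤ) {s : Set (ℕ → Fin d → ℤ)} (hs : MeasurableSet s) :
    annealedLaw μ x {Y | (fun k => Y k - x) ∈ s} = annealedLaw μ 0 s := by
  have h : annealedLaw μ x = (annealedLaw μ 0).map fun Y k => Y k + x := by
    rw [← annealedLaw_add, zero_add]
  have hm : Measurable fun (Y : ℕ → Fin d → ℤ) k => Y k - x := by fun_prop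
  have hm' : Measurable fun (Y : ℕ → Fin d → ℤ) k => Y k + x := by fun_prop
  change annealedLaw μ x ((fun Y k => Y k - x) ⁻¹' s) = _
  rw [h, Measure.map_apply hm' (hm hs)]
  congr 1
  ext Y
  simp

/-- If at each good time the walk has a chance `p > 0` of performing, on fresh sites, a
continuation that rules out `B`, then almost surely on `B` there are finitely many good times. -/
theorem annealedLaw_frequently_inter_eq_zero (x : Fin d → ℤ) {B : Set (ℕ → Fin d → ℤ)}
    {good : ℕ → Set (ℕ → Fin d → ℤ)} {p : ENNReal} (hp : p ≠ 0) (hgood : ∀ n, Det n (good n))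
    (h : ∀ n, ∀ X ∈ good n, ∃ (s : Set (ℕ → Fin d → ℤ)) (T : Set (Fin d → ℤ)), MeasurableSet s ∧
      DependsOn (fun ω => quenchedLaw (X n) ω s) T ∧ (∀ i < n, X i ∉ T) ∧
      p ≤ annealedLaw μ (X n) s ∧ ∀ Y ∈ cyl X n, (fun k => Y (n + k)) ∈ s → Y ∉ B) :
    annealedLaw μ x ({X | ∃ᶠ n in atTop, X ∈ good n} ∩ B) = 0 := by
  refine measure_inter_frequently_eq_zero (c := 1 - p)
    (ENNReal.sub_lt_self ENNReal.one_ne_top one_ne_zero hp) hgood fun n X hX => ?_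
  obtain ⟨s, T, hs, hT, hXT, hps, hsB⟩ := h n X hX
  have hm := measurable_shift n hs
  have hp1 : p ≤ 1 := hps.trans prob_le_one
  have hsub : cyl X n ∩ B ⊆ cyl X n \ (cyl X n ∩ (fun Y k => Y (n + k)) ⁻¹' s) :=
    fun Y hY => ⟨hY.1, fun hY' => hsB Y hY.1 hY'.2 hY.2⟩
  calc annealedLaw μ x (cyl X n ∩ B)
      ≤ annealedLaw μ x (cyl X n \ (cyl X n ∩ (fun Y k => Y (n + k)) ⁻¹' s)) := measure_mono hsub
    _ = annealedLaw μ x (cyl X n) - annealedLaw μ x (cyl X n) * annealedLaw μ (X n) s := by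
        rw [measure_sdiff Set.inter_subset_left
          ((measurableSet_cyl X n).inter hm).nullMeasurableSet (measure_ne_top _ _),
          annealedLaw_cyl_inter_shift x X n hs hT hXT]
    _ ≤ annealedLaw μ x (cyl X n) - annealedLaw μ x (cyl X n) * p := by gcongr
    _ = (1 - p) * annealedLaw μ x (cyl X n) := by
        rw [ENNReal.sub_mul fun _ _ => measure_ne_top _ _, one_mul, mul_comm p]

theorem dependsOn_quenchedLaw_forall_mem (x : Fin d → ℤ) (A : Set (Fin d → ℤ)) :
    DependsOn (fun ω : Env d => quenchedLaw x ω {Y | ∀ k, Y k ∈ A}) A := fun _ _ h =>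
  quenchedLaw_eq_of_eqOn h x (measurableSet_forall_mem A) fun _ hX => hX

/-- The case where the good times are records of the level in the direction `m` and the continuation
consists in staying in a translate of a subset `A` of the half-plane `0 ≤ · m`: at a record, all
sites of this half-plane as seen from the walk are fresh. -/
theorem annealedLaw_frequently_record_eq_zero (x : Fin d → ℤ) {m : Fin d → ℝ}
    {A : Set (Fin d → ℤ)} (hA : ∀ y ∈ A, 0 ≤ lev m y)
    (hp : annealedLaw μ 0 {Y | ∀ k, Y k ∈ A} ≠ 0) {B : Set (ℕ → Fin d → ℤ)}
    {good : ℕ → Set (ℕ → Fin d → ℤ)} (hgood : ∀ n, Det n (good n))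
    (hrec : ∀ n, ∀ X ∈ good n, ∀ i < n, lev m (X i) < lev m (X n))
    (hB : ∀ n, ∀ X ∈ good n, ∀ Y ∈ cyl X n, (∀ k, Y (n + k) - X n ∈ A) → Y ∉ B) :
    annealedLaw μ x ({X | ∃ᶠ n in atTop, X ∈ good n} ∩ B) = 0 := by
  refine annealedLaw_frequently_inter_eq_zero x hp hgood fun n X hX =>
    ⟨{Y | ∀ k, Y k ∈ {y | y - X n ∈ A}}, {y | y - X n ∈ A}, measurableSet_forall_mem _,
      dependsOn_quenchedLaw_forall_mem _ _, fun i hi hiA => ?_, ?_, hB n X hX⟩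
  · have := hA _ hiA
    rw [lev_sub] at this
    linarith [hrec n X hX i hi]
  · exact (annealedLaw_sub_mem (X n) (measurableSet_forall_mem A)).ge

/-- If the walk has a positive chance of never backtracking below its starting level, then almost
surely it is transient as soon as it is unbounded above. -/
theorem ae_transient_of_not_bddAbove (x : Fin d → ℤ) {m : Fin d → ℝ}
    (hp : annealedLaw μ 0 {Y | ∀ k, 0 ≤ lev m (Y k)} ≠ 0) :
    ∀ᵐ X ∂annealedLaw μ x,
      ¬ BddAbove (Set.range fun n => lev m (X n)) → X ∈ transientEvent m := by
  have key : ∀ u : ℕ, annealedLaw μ x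
      ({X | ∃ᶠ n in atTop, X ∈ {X | (∀ i < n, lev m (X i) < lev m (X n)) ∧ (u : ℝ) ≤ lev m (X n)}} ∩
        {X | ∃ᶠ n in atTop, lev m (X n) < u}) = 0 := by
    intro u
    refine annealedLaw_frequently_record_eq_zero x (A := {y | 0 ≤ lev m y}) (fun y hy => hy) hp
      (fun n X Y hY hX => ?_) (fun n X hX => hX.1) fun n X hX Y hY hstay hYB => ?_
    · refine ⟨fun i hi => ?_, ?_⟩
      · rw [hY i hi.le, hY n le_rfl]; exact hX.1 i hi
      · rw [hY n le_rfl]; exact hX.2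
    · obtain ⟨k, hk, hlt⟩ := (frequently_atTop.1 hYB) n
      obtain ⟨j, rfl⟩ := Nat.exists_eq_add_of_le hk
      have h1 := hstay j
      rw [Set.mem_ofPred_eq, lev_sub] at h1
      linarith [hX.2]
  have key' := ae_all_iff.2 fun u => measure_eq_zero_iff_ae_notMem.1 (key u)
  filter_upwards [key'] with X hX hunb
  rw [mem_transientEvent]
  refine tendsto_atTop.2 fun b => ?_
  obtain ⟨u, hu⟩ := exists_nat_ge b
  by_contra hb
  refine hX u ⟨frequently_record hunb u, ?_⟩
  refine (not_eventually.1 hb).mono fun n hn => ?_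
  exact (not_le.1 hn).trans_le hu

/-- Looking from the time at which the minimal level is attained, a transient walk does not
backtrack. -/
theorem annealedLaw_nonbacktracking_ne_zero {m : Fin d → ℝ}
    (h : annealedLaw μ 0 (transientEvent m) ≠ 0) :
    annealedLaw μ 0 {X | (∀ n, 0 ≤ lev m (X n)) ∧ X ∈ transientEvent m} ≠ 0 := by
  intro h0
  refine h ?_
  have hms : MeasurableSet {X : ℕ → Fin d → ℤ | (∀ n, 0 ≤ lev m (X n)) ∧ X ∈ transientEvent m} :=
    (measurableSet_forall_lev m 0).inter (measurableSet_transientEvent m)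
  have hm : ∀ y : Fin d → ℤ, Measurable fun (Y : ℕ → Fin d → ℤ) k => Y k - y := by
    intro y; fun_prop
  refine measure_mono_null ?_ (annealedLaw_exists_shift_mem_eq_zero 0
    (s := fun y => {Y | (fun k => Y k - y) ∈ {X : ℕ → Fin d → ℤ |
      (∀ n, 0 ≤ lev m (X n)) ∧ X ∈ transientEvent m}}) (fun y => hm y hms) fun y => by
        rw [annealedLaw_sub_mem y hms, h0])
  intro X hX
  have hlim := mem_transientEvent.1 hX
  obtain ⟨n, hn⟩ := (Nat.cofinite_eq_atTop ▸ hlim).exists_forall_le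
  refine ⟨n, fun k => ?_, ?_⟩
  · rw [lev_sub]
    linarith [hn (n + k)]
  · have := (transientEvent_add (l := m) (X := fun k => X (n + k)) (-X n)).2
      ((transientEvent_shift n).2 hX)
    simpa [sub_eq_add_neg] using this

end Renewal

/-! ### Traps -/

section Trap

variable {d : ℕ}

/-- The `d` unit vectors `s i • e_i`, one for each axis, with the signs given by `s`. -/
def orthantSteps (s : Fin d → ℤ) : Set (unitSteps d) :=
  {e | ∃ i, (e : Fin d → ℤ) = Pi.single i (s i)}

theorem stepLaw_ne_zero_imp {ω : Env d} {y z : Fin d → ℤ} (h : stepLaw ω y {z} ≠ 0) :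
    ∃ e : unitSteps d, z = y + e ∧ (ω y : Measure (unitSteps d)) {e} ≠ 0 := by
  have he := sub_mem_unitSteps_of_stepLaw_ne_zero h
  refine ⟨⟨z - y, he⟩, by simp, ?_⟩
  rw [← stepLaw_singleton_add]
  simpa using h

theorem ae_envLaw_forall {μ : Measure (LocalEnv d)} [IsProbabilityMeasure μ]
    {p : LocalEnv d → Prop} (hp : ∀ᵐ γ ∂μ, p γ) : ∀ᵐ ω ∂envLaw μ, ∀ y, p (ω y) := by
  refine ae_all_iff.2 fun y => ?_
  exact (measurePreserving_eval_infinitePi (fun _ : Fin d → ℤ => μ) y).quasiMeasurePreserving.ae hp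

theorem measurable_localEnv_apply (E : Set (unitSteps d)) :
    Measurable fun γ : LocalEnv d => (γ : Measure (unitSteps d)) E :=
  (Measure.measurable_coe (Set.to_countable E).measurableSet).comp measurable_subtype_coe

/-- Infinitely many visits to `y` entail infinitely many visits to each `z` that can be reached
from `y` in one step. -/
theorem ae_frequently_of_stepLaw_ne_zero (x : Fin d → ℤ) (ω : Env d) {y z : Fin d → ℤ}
    (h : stepLaw ω y {z} ≠ 0) :
    ∀ᵐ X ∂quenchedLaw x ω, (∃ᶠ n in atTop, X n = y) → ∃ᶠ n in atTop, X n = z := by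
  have key : ∀ N : ℕ, quenchedLaw x ω
      ({X | ∃ᶠ n in atTop, X ∈ {X : ℕ → Fin d → ℤ | N ≤ n ∧ X n = y}} ∩
        {X | ∀ n ≥ N, X n ≠ z}) = 0 := by
    intro N
    refine measure_inter_frequently_eq_zero (c := 1 - stepLaw ω y {z})
      (ENNReal.sub_lt_self ENNReal.one_ne_top one_ne_zero h) (fun n X Y hY hX => ?_)
      fun n X hX => ?_
    · exact ⟨hX.1, by rw [hY n le_rfl]; exact hX.2⟩
    · set W := Function.update X (n + 1) z with hW
      have hWX : ∀ i ≤ n, W i = X i := fun i hi => by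
        rw [hW, Function.update_of_ne (by omega)]
      have hWn : W (n + 1) = z := by simp [hW]
      have hsub : cyl X n ∩ {X | ∀ n ≥ N, X n ≠ z} ⊆ cyl X n \ cyl W (n + 1) :=
        fun Y hY => ⟨hY.1, fun hY' => hY.2 (n + 1) (by have := hX.1; omega)
          ((hY' (n + 1) le_rfl).trans hWn)⟩
      have hcyl : cyl W n = cyl X n := cyl_eq_of_mem hWX
      refine (measure_mono hsub).trans_eq ?_
      rw [measure_sdiff (hcyl ▸ cyl_anti W n.le_succ) (measurableSet_cyl W _).nullMeasurableSet
        (measure_ne_top _ _), quenchedLaw_cyl_succ, hcyl, hWX n le_rfl, hWn, hX.2,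
        ENNReal.sub_mul fun _ _ => measure_ne_top _ _, one_mul, mul_comm (stepLaw ω y {z})]
  have key' := ae_all_iff.2 fun N => measure_eq_zero_iff_ae_notMem.1 (key N)
  filter_upwards [key'] with X hX hy hz
  obtain ⟨N, hN⟩ := eventually_atTop.1 hz
  refine hX N ⟨?_, hN⟩
  exact (hy.and_eventually (eventually_ge_atTop N)).mono fun n hn => ⟨hn.2, hn.1⟩

/-- If every site offers a step into a fixed orthant, then the walk does not get stuck in a finite
set: among the sites visited infinitely often there would be a last one in the direction of the
orthant. -/
theorem ae_infinite_range (x : Fin d → ℤ) {ω : Env d} {s : Fin d → ℤ} (hs : ∀ i, 0 < s i * s i)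
    (hω : ∀ y, (ω y : Measure (unitSteps d)) (orthantSteps s) ≠ 0) :
    ∀ᵐ X ∂quenchedLaw x ω, (Set.range X).Infinite := by
  have hstep : ∀ y, ∃ i, stepLaw ω y {y + Pi.single i (s i)} ≠ 0 := by
    intro y
    by_contra! h
    refine hω y ((measure_null_iff_singleton (Set.to_countable _)).2 fun e he => ?_)
    obtain ⟨i, hi⟩ := he
    rw [← stepLaw_singleton_add, hi]
    exact h i
  choose i hi using hstep
  have hrec := ae_all_iff.2 fun y => ae_frequently_of_stepLaw_ne_zero x ω (hi y)
  filter_upwards [hrec] with X hX hfin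
  set R : Set (Fin d → ℤ) := {y | ∃ᶠ n in atTop, X n = y} with hR
  have hRfin : R.Finite := hfin.subset fun y hy => (Frequently.exists hy).imp fun n hn => hn
  have hne : R.Nonempty := by
    by_contra! h
    have : ∀ᶠ n in atTop, ∀ y ∈ Set.range X, X n ≠ y :=
      (eventually_all_finite hfin).2 fun y _ => not_frequently.1
        (show y ∉ R by rw [h]; exact Set.notMem_empty y)
    obtain ⟨n, hn⟩ := this.exists
    exact hn (X n) ⟨n, rfl⟩ rfl
  obtain ⟨y, hy, hmax⟩ := hRfin.exists_maximalFor (fun y => ∑ j, y j * s j) R hne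
  have h1 := hmax (hX y hy)
  have h2 : (∑ j, (y + Pi.single (i y) (s (i y)) : Fin d → ℤ) j * s j) =
      (∑ j, y j * s j) + s (i y) * s (i y) := by
    simp only [Pi.add_apply, add_mul, Finset.sum_add_distrib]
    congr 1
    rw [Finset.sum_eq_single (i y)] <;> simp +contextual
  have h3 := hs (i y)
  simp only [h2] at h1
  have := h1 (by omega)
  omega

/-- If for each orthant a site may offer no step into that orthant, then a cube none of whose
corners offers a step out of the cube is a trap, and almost surely the walk is bounded above in each
direction. -/
theorem ae_bddAbove_of_trap {μ : Measure (LocalEnv d)} [IsProbabilityMeasure μ]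
    (h : ∀ s : Fin d → ℤ, (∀ i, s i = 1 ∨ s i = -1) →
      μ {γ | (γ : Measure (unitSteps d)) (orthantSteps s) = 0} ≠ 0)
    (x : Fin d → ℤ) (l : Fin d → ℝ) :
    ∀ᵐ X ∂annealedLaw μ x, BddAbove (Set.range fun n => lev l (X n)) := by
  classical
  set σ : Fin d → ℤ := fun i => if 0 ≤ l i then 1 else -1 with hσ
  have hσ1 : ∀ i, σ i = 1 ∨ σ i = -1 := fun i => by simp only [hσ]; split_ifs <;> simp
  have hσl : ∀ i, 0 ≤ (σ i : ℝ) * l i := fun i => by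
    simp only [hσ]
    split_ifs with hi
    · simpa using hi
    · push_cast; linarith
  set A : Set (Fin d → ℤ) := Set.pi Set.univ fun i => {0, σ i} with hA
  have hAfin : A.Finite := Set.Finite.pi fun i => Set.toFinite _
  -- the outward pointing signs at the corner `y` of the cube
  set τ : (Fin d → ℤ) → Fin d → ℤ := fun y i => if y i = 0 then -σ i else σ i with hτ
  have hτ1 : ∀ y i, τ y i = 1 ∨ τ y i = -1 := fun y i => by
    simp only [hτ]; rcases hσ1 i with h | h <;> split_ifs <;> simp [h]
  have hpos : ∀ y ∈ A, 0 ≤ lev l y := by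
    intro y hy
    refine Finset.sum_nonneg fun i _ => ?_
    rcases hy i trivial with h0 | h1
    · simp [h0]
    · rw [h1]; exact hσl i
  have hp : annealedLaw μ 0 {Y | ∀ k, Y k ∈ A} ≠ 0 := by
    intro h0
    rw [annealedLaw_eq_zero_iff 0 (measurableSet_forall_mem A)] at h0
    have htrap : envLaw μ (Set.pi hAfin.toFinset fun y =>
        {γ : LocalEnv d | (γ : Measure (unitSteps d)) (orthantSteps (τ y)) = 0}) ≠ 0 := by
      have hms : ∀ y, MeasurableSet {γ : LocalEnv d |
          (γ : Measure (unitSteps d)) (orthantSteps (τ y)) = 0} := fun y =>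
        measurable_localEnv_apply _ (measurableSet_singleton 0)
      rw [envLaw, Measure.infinitePi_pi _ fun y _ => hms y]
      exact Finset.prod_ne_zero_iff.2 fun y _ => h (τ y) (hτ1 y)
    refine htrap (measure_mono_null (fun ω hω => ?_) (ae_iff.1 h0))
    intro h1
    have hstay : ∀ᵐ Y ∂quenchedLaw 0 ω, ∀ k, Y k ∈ A := by
      filter_upwards [ae_quenchedLaw_stepLaw_ne_zero 0 ω] with Y hY k
      induction k with
      | zero => rw [hY.1]; exact fun i _ => Or.inl rfl
      | succ k ih =>
        obtain ⟨e, he, he0⟩ := stepLaw_ne_zero_imp (hY.2 k)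
        have hout : e ∉ orthantSteps (τ (Y k)) := fun heo => he0
          (measure_mono_null (Set.singleton_subset_iff.2 heo)
            (hω (Y k) (by simpa using ih)))
        rw [he]
        intro i _
        have hi := ih i trivial
        obtain ⟨j, hj⟩ := e.2
        by_cases hij : i = j
        · subst hij
          have hout' : ¬ (e : Fin d → ℤ) = Pi.single i (τ (Y k) i) := fun hh => hout ⟨i, hh⟩
          have hei : (e : Fin d → ℤ) i = -τ (Y k) i := by
            rcases hj with hj | hj <;> rcases hτ1 (Y k) i with ht | ht
            · exact absurd (by rw [hj, ht]) hout'
            · rw [hj, ht]; simp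
            · rw [hj, ht]; simp
            · exact absurd (by rw [hj, ht, Pi.single_neg]) hout'
          have hsum : (Y k + (e : Fin d → ℤ)) i = Y k i - τ (Y k) i := by
            rw [Pi.add_apply, hei, sub_eq_add_neg]
          change (Y k + (e : Fin d → ℤ)) i = 0 ∨ (Y k + (e : Fin d → ℤ)) i = σ i
          rw [hsum]
          have hi' : Y k i = 0 ∨ Y k i = σ i := hi
          simp only [hτ]
          rcases hi' with h2 | h2
          · right; simp [h2]
          · left
            rw [h2]
            have : σ i ≠ 0 := by rcases hσ1 i with h | h <;> simp [h]
            simp [this]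
        · have hei : (e : Fin d → ℤ) i = 0 := by
            rcases hj with hj | hj <;> simp [hj, hij]
          change (Y k + (e : Fin d → ℤ)) i ∈ _
          rw [Pi.add_apply, hei, add_zero]
          exact hi
    have h3 : quenchedLaw 0 ω {Y | ∀ k, Y k ∈ A} = 1 :=
      (prob_compl_eq_zero_iff (measurableSet_forall_mem A)).1 hstay
    rw [h3] at h1
    exact one_ne_zero h1
  have key := annealedLaw_frequently_record_eq_zero x hpos hp
    (B := {X | ¬ BddAbove (Set.range fun n => lev l (X n))})
    (good := fun n => {X | ∀ i < n, lev l (X i) < lev l (X n)})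
    (fun n X Y hY hX i hi => by rw [hY i hi.le, hY n le_rfl]; exact hX i hi)
    (fun n X hX => hX) fun n X _ Y _ hstay hYB => by
      refine hYB ?_
      have hfin : ((fun k => lev l (Y k)) '' Set.Iio n ∪
          (fun y => lev l (y + X n)) '' A).Finite :=
        ((Set.finite_Iio n).image _).union (hAfin.image _)
      refine hfin.bddAbove.mono ?_
      rintro _ ⟨k, rfl⟩
      by_cases hk : k < n
      · exact Or.inl ⟨k, hk, rfl⟩
      · obtain ⟨j, rfl⟩ := Nat.exists_eq_add_of_le (not_lt.1 hk)
        exact Or.inr ⟨_, hstay j, by simp⟩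
  filter_upwards [measure_eq_zero_iff_ae_notMem.1 key] with X hX
  by_contra hb
  exact hX ⟨(frequently_record hb 0).mono fun n hn => hn.1, hb⟩

end Trap

/-! ### Kalikow's zero-one law -/

section Kalikow

variable {d : ℕ} {μ : Measure (LocalEnv d)} [IsProbabilityMeasure μ]

theorem lev_nsmul (l : Fin d → ℝ) (k : ℕ) (x : Fin d → ℤ) : lev l (k • x) = k * lev l x := by
  simp [lev, Finset.mul_sum, mul_assoc]

/-- The walk has a positive chance of starting with `K` steps `e` if the step `e` is possible. -/
theorem annealedLaw_cyl_ray_ne_zero {e : unitSteps d}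
    (hμ : μ {γ | (γ : Measure (unitSteps d)) {e} ≠ 0} ≠ 0) (K : ℕ) :
    annealedLaw μ 0 (cyl (fun k => k • (e : Fin d → ℤ)) K) ≠ 0 := by
  classical
  intro h0
  rw [annealedLaw_eq_zero_iff 0 (measurableSet_cyl _ _)] at h0
  have hms : MeasurableSet {γ : LocalEnv d | (γ : Measure (unitSteps d)) {e} ≠ 0} :=
    (measurable_localEnv_apply {e} (measurableSet_singleton 0)).compl
  have hpos : envLaw μ (Set.pi ((Finset.range K).image fun k => k • (e : Fin d → ℤ)) fun _ =>
      {γ : LocalEnv d | (γ : Measure (unitSteps d)) {e} ≠ 0}) ≠ 0 := by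
    rw [envLaw, Measure.infinitePi_pi _ fun _ _ => hms]
    exact Finset.prod_ne_zero_iff.2 fun _ _ => hμ
  refine hpos (measure_mono_null (fun ω hω => ?_) (ae_iff.1 h0))
  intro h1
  rw [quenchedLaw_cyl, if_pos (zero_smul ℕ _), Finset.prod_eq_zero_iff] at h1
  obtain ⟨k, hk, h2⟩ := h1
  rw [succ_nsmul, stepLaw_singleton_add] at h2
  exact hω _ (by simpa using ⟨k, Finset.mem_range.1 hk, rfl⟩) h2

theorem finite_update_lev {l : Fin d → ℝ} {i : Fin d} (hi : l i ≠ 0) {F : Set (Fin d → ℤ)}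
    (hF : F.Finite) (u v : ℝ) :
    {y : Fin d → ℤ | Function.update y i 0 ∈ F ∧ v ≤ lev l y ∧ lev l y ≤ u}.Finite := by
  have hsub : {y : Fin d → ℤ | Function.update y i 0 ∈ F ∧ v ≤ lev l y ∧ lev l y ≤ u} ⊆
      ⋃ w ∈ F, (fun a : ℤ => w + Pi.single i a) ''
        {a : ℤ | v - lev l w ≤ a * l i ∧ a * l i ≤ u - lev l w} := by
    rintro y ⟨hy, hv, hu⟩
    have hyw : Function.update y i 0 + Pi.single i (y i) = y := by
      ext j
      by_cases hj : j = i
      · subst hj; simp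
      · simp [hj]
    have hl : lev l y = lev l (Function.update y i 0) + y i * l i := by
      conv_lhs => rw [← hyw]
      rw [lev_add, lev_single]
    refine Set.mem_biUnion hy ⟨y i, ⟨?_, ?_⟩, hyw⟩ <;> linarith
  refine Set.Finite.subset (hF.biUnion fun w _ => Set.Finite.image _ ?_) hsub
  obtain ⟨N, hN⟩ := exists_nat_ge ((|v - lev l w| + |u - lev l w|) / |l i|)
  refine (Set.finite_Icc (-(N : ℤ)) N).subset fun a ha => ?_
  have h1 : |(a : ℝ) * l i| ≤ |v - lev l w| + |u - lev l w| := by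
    rw [abs_le]
    constructor
    · linarith [ha.1, neg_abs_le (v - lev l w), abs_nonneg (u - lev l w)]
    · linarith [ha.2, le_abs_self (u - lev l w), abs_nonneg (v - lev l w)]
  have h2 : |(a : ℝ)| ≤ N := by
    refine le_trans ?_ hN
    rw [le_div_iff₀ (abs_pos.2 hi), ← abs_mul]
    exact h1
  have h3 : |a| ≤ N := by exact_mod_cast h2
  exact abs_le.1 h3

/-- A walk that is bounded above visits only finitely many sites above each level: whenever it
visits, above the given level, a line parallel to the upward step `e` that it has not visited there
before, it has a fixed chance of running upwards along this line on fresh sites and thereby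
exceeding the bound. -/
theorem ae_finite_of_bddAbove (x : Fin d → ℤ) {l : Fin d → ℝ} {e : unitSteps d}
    (he : 0 < lev l e) (hμ : μ {γ | (γ : Measure (unitSteps d)) {e} ≠ 0} ≠ 0) :
    ∀ᵐ X ∂annealedLaw μ x, BddAbove (Set.range fun n => lev l (X n)) →
      ∀ v, {y | y ∈ Set.range X ∧ v ≤ lev l y}.Finite := by
  obtain ⟨i, hi⟩ := e.2
  have hli : l i ≠ 0 := by
    intro h0
    rcases hi with h | h
    · rw [h, lev_single, h0] at he; simp at he
    · rw [h, ← Pi.single_neg, lev_single, h0] at he; simp at he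
  set π : (Fin d → ℤ) → Fin d → ℤ := fun y => Function.update y i 0 with hπ
  have hπe : ∀ y (k : ℕ), π (y + k • (e : Fin d → ℤ)) = π y := by
    intro y k
    ext j
    by_cases hj : j = i
    · subst hj; simp [hπ]
    · rcases hi with h | h <;> simp [hπ, h, hj]
  set good : ℕ → ℕ → ℕ → Set (ℕ → Fin d → ℤ) := fun u v n =>
    {X | -(v : ℝ) ≤ lev l (X n) ∧ ∀ i < n, -(v : ℝ) ≤ lev l (X i) → π (X i) ≠ π (X n)} with hgood
  have key : ∀ u v : ℕ, annealedLaw μ x ({X | ∃ᶠ n in atTop, X ∈ good u v n} ∩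
      {X | ∀ n, lev l (X n) ≤ u}) = 0 := by
    intro u v
    obtain ⟨K, hK⟩ := exists_nat_gt ((u + v) / lev l e)
    rw [div_lt_iff₀ he] at hK
    refine annealedLaw_frequently_inter_eq_zero x (annealedLaw_cyl_ray_ne_zero hμ K)
      (fun n X Y hY hX => ?_) fun n X hX =>
      ⟨cyl (fun k => X n + k • (e : Fin d → ℤ)) K, _, measurableSet_cyl _ _,
        dependsOn_quenchedLaw_cyl _ _ _, ?_, ?_, ?_⟩
    · refine ⟨by rw [hY n le_rfl]; exact hX.1, fun i hi h => ?_⟩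
      rw [hY n le_rfl, hY i hi.le]
      rw [hY i hi.le] at h
      exact hX.2 i hi h
    · rintro j hj ⟨k, -, hk⟩
      have hk' : X j = X n + k • (e : Fin d → ℤ) := hk.symm
      refine hX.2 j hj ?_ (by rw [hk', hπe])
      rw [hk', lev_add, lev_nsmul]
      have : (0 : ℝ) ≤ k * lev l e := by positivity
      linarith [hX.1]
    · rw [← annealedLaw_sub_mem (X n) (measurableSet_cyl _ _)]
      refine measure_mono fun Y hY k hk => ?_
      have := hY k hk
      simp only at this
      change Y k = X n + k • (e : Fin d → ℤ)
      rw [← this]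
      abel
    · intro Y _ hY hYB
      have h1 := hY K le_rfl
      have h2 := hYB (n + K)
      simp only at h1
      rw [h1, lev_add, lev_nsmul] at h2
      linarith [hX.1]
  have key' := ae_all_iff.2 fun u => ae_all_iff.2 fun v => measure_eq_zero_iff_ae_notMem.1 (key u v)
  filter_upwards [key'] with X hX hb w
  obtain ⟨b, hb⟩ := hb
  obtain ⟨u, hu⟩ := exists_nat_ge b
  obtain ⟨v, hv⟩ := exists_nat_ge (-w)
  have hXu : ∀ n, lev l (X n) ≤ u := fun n => (hb ⟨n, rfl⟩).trans hu
  have hev : ∀ᶠ n in atTop, X ∉ good u v n := by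
    rw [← not_frequently]
    exact fun hf => hX u v ⟨hf, hXu⟩
  obtain ⟨N, hN⟩ := eventually_atTop.1 hev
  have hind : ∀ n, -(v : ℝ) ≤ lev l (X n) → π (X n) ∈ (fun k => π (X k)) '' Set.Iio N := by
    intro n
    induction n using Nat.strong_induction_on with
    | _ n ih =>
      intro hn
      by_cases hnN : n < N
      · exact ⟨n, hnN, rfl⟩
      · have := hN n (not_lt.1 hnN)
        simp only [hgood, Set.mem_ofPred_eq, not_and, not_forall] at this
        obtain ⟨j, hj, hjv, hjn⟩ := this hn
        rw [← not_not.1 hjn]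
        exact ih j hj hjv
  refine (finite_update_lev hli ((Set.finite_Iio N).image fun k => π (X k)) u (-v)).subset ?_
  rintro _ ⟨⟨n, rfl⟩, hn⟩
  have : -(v : ℝ) ≤ lev l (X n) := by linarith
  exact ⟨hind n this, this, hXu n⟩

theorem exists_up_step {l : Fin d → ℝ} (h : annealedLaw μ 0 (transientEvent l) ≠ 0) :
    ∃ e : unitSteps d, 0 < lev l e ∧ μ {γ | (γ : Measure (unitSteps d)) {e} ≠ 0} ≠ 0 := by
  by_contra! hcon
  refine h ((annealedLaw_eq_zero_iff 0 (measurableSet_transientEvent l)).2 ?_)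
  have h1 : ∀ᵐ γ : LocalEnv d ∂μ, ∀ e : unitSteps d, 0 < lev l e →
      (γ : Measure (unitSteps d)) {e} = 0 := by
    refine ae_all_iff.2 fun e => ?_
    by_cases he : 0 < lev l e
    · simpa [he] using ae_iff.2 (hcon e he)
    · simp [he]
  filter_upwards [ae_envLaw_forall h1] with ω hω
  refine measure_eq_zero_iff_ae_notMem.2 ?_
  filter_upwards [ae_quenchedLaw_stepLaw_ne_zero 0 ω] with X hX hXt
  have hle : ∀ n, lev l (X n) ≤ 0 := by
    intro n
    induction n with
    | zero => rw [hX.1, lev_zero]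
    | succ n ih =>
      obtain ⟨e, he, he0⟩ := stepLaw_ne_zero_imp (hX.2 n)
      rw [he, lev_add]
      have : ¬ 0 < lev l e := fun hpos => he0 (hω (X n) e hpos)
      linarith
  obtain ⟨n, hn⟩ := ((mem_transientEvent.1 hXt).eventually_gt_atTop 0).exists
  exact absurd (hle n) (not_le.2 hn)

theorem not_bddAbove_of_transient {l : Fin d → ℝ} {X : ℕ → Fin d → ℤ}
    (hX : X ∈ transientEvent l) : ¬ BddAbove (Set.range fun n => lev l (X n)) :=
  not_bddAbove_of_tendsto_atTop (mem_transientEvent.1 hX)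

/-- Kalikow's zero-one law for the union of the two opposite transience events, without
ellipticity: if transience in direction `l` has a probability strictly between `0` and `1`, then
transience in direction `-l` has positive probability. -/
theorem annealedLaw_transientEvent_neg_ne_zero {l : Fin d → ℝ}
    (h0 : annealedLaw μ 0 (transientEvent l) ≠ 0) (h1 : annealedLaw μ 0 (transientEvent l) ≠ 1) :
    annealedLaw μ 0 (transientEvent (-l)) ≠ 0 := by
  intro hneg
  have hnot : ¬ ∀ᵐ X ∂annealedLaw μ 0, X ∈ transientEvent l := fun hae =>
    h1 ((prob_compl_eq_zero_iff (measurableSet_transientEvent l)).1 hae)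
  have hpos : annealedLaw μ 0 {Y | ∀ k, 0 ≤ lev l (Y k)} ≠ 0 := fun hz =>
    annealedLaw_nonbacktracking_ne_zero h0 (measure_mono_null (fun X hX => hX.1) hz)
  have hup := ae_transient_of_not_bddAbove 0 hpos
  -- the walk cannot be trapped in a finite set
  have hinf : ∀ᵐ X ∂annealedLaw μ 0, (Set.range X).Infinite := by
    by_cases htrap : ∀ s : Fin d → ℤ, (∀ i, s i = 1 ∨ s i = -1) →
      μ {γ | (γ : Measure (unitSteps d)) (orthantSteps s) = 0} ≠ 0
    · refine absurd (measure_eq_zero_iff_ae_notMem.2 ?_) h0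
      filter_upwards [ae_bddAbove_of_trap htrap 0 l] with X hX hXt
      exact not_bddAbove_of_transient hXt hX
    · push Not at htrap
      obtain ⟨s, hs, hμs⟩ := htrap
      have hω : ∀ᵐ γ : LocalEnv d ∂μ, (γ : Measure (unitSteps d)) (orthantSteps s) ≠ 0 :=
        measure_eq_zero_iff_ae_notMem.1 hμs
      have hfinm : MeasurableSet {X : ℕ → Fin d → ℤ | (Set.range X).Infinite} := by
        have : {X : ℕ → Fin d → ℤ | (Set.range X).Infinite} =
            (⋃ F : Finset (Fin d → ℤ), {X | ∀ n, X n ∈ (F : Set (Fin d → ℤ))})ᶜ := by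
          ext X
          simp only [Set.mem_ofPred_eq, Set.mem_compl_iff, Set.mem_iUnion, Set.Infinite]
          refine not_congr ⟨fun hf => ⟨hf.toFinset, fun n => by simp⟩, ?_⟩
          rintro ⟨F, hF⟩
          exact F.finite_toSet.subset (Set.range_subset_iff.2 hF)
        rw [this]
        exact (MeasurableSet.iUnion fun F => measurableSet_forall_mem _).compl
      refine ae_annealedLaw hfinm ?_
      filter_upwards [ae_envLaw_forall hω] with ω hω
      exact ae_infinite_range 0 (fun i => by rcases hs i with h | h <;> simp [h]) hω
  obtain ⟨e, he, hμe⟩ := exists_up_step h0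
  have hfin := ae_finite_of_bddAbove 0 he hμe
  -- otherwise the maximal level is attained, after which the walk stays below it
  have hpos' : annealedLaw μ 0 {Y | ∀ k, 0 ≤ lev (-l) (Y k)} ≠ 0 := by
    intro hz
    have hm : ∀ y : Fin d → ℤ, Measurable fun (Y : ℕ → Fin d → ℤ) k => Y k - y := by
      intro y; fun_prop
    have hmax := annealedLaw_exists_shift_mem_eq_zero (μ := μ) 0
      (s := fun y => {Y | (fun k => Y k - y) ∈ {Y : ℕ → Fin d → ℤ | ∀ k, 0 ≤ lev (-l) (Y k)}})
      (fun y => hm y (measurableSet_forall_lev (-l) 0)) fun y => by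
        rw [annealedLaw_sub_mem y (measurableSet_forall_lev (-l) 0), hz]
    refine hnot ?_
    filter_upwards [hup, hfin, measure_eq_zero_iff_ae_notMem.1 hmax] with X hX1 hX2 hX3
    refine hX1 fun hb => hX3 ?_
    obtain ⟨y, ⟨⟨n, rfl⟩, hn⟩, hy⟩ := (hX2 hb (lev l (X 0))).exists_maximalFor (lev l) _
      ⟨X 0, ⟨0, rfl⟩, le_rfl⟩
    refine ⟨n, fun k => ?_⟩
    rw [lev_sub, lev_neg_left, lev_neg_left]
    rcases le_total (lev l (X (n + k))) (lev l (X n)) with hle | hle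
    · linarith
    · have := hy ⟨⟨n + k, rfl⟩, hn.trans hle⟩ hle
      linarith
  have hdown := ae_transient_of_not_bddAbove 0 hpos'
  refine hnot ?_
  filter_upwards [hup, hdown, measure_eq_zero_iff_ae_notMem.1 hneg, hfin, hinf]
    with X hX1 hX2 hX3 hX4 hX5
  refine hX1 fun hb => hX5 ?_
  have hb' : BddAbove (Set.range fun n => lev (-l) (X n)) := by
    by_contra hcon
    exact hX3 (hX2 hcon)
  obtain ⟨b, hb'⟩ := hb'
  refine (hX4 hb (-b)).subset ?_
  rintro _ ⟨n, rfl⟩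
  have := hb' ⟨n, rfl⟩
  simp only [lev_neg_left] at this
  exact ⟨⟨n, rfl⟩, by linarith⟩

end Kalikow

/-! ### Crossing numbers of planar paths -/

section Planar

/-- The indicator of the closed half-plane `0 ≤ x · l`. -/
noncomputable def halfInd (l : Fin 2 → ℝ) (x : Fin 2 → ℤ) : ℤ :=
  open Classical in if 0 ≤ lev l x then 1 else 0

/-- The signed number of times (`0`, `1` or `-1`) that the lattice step from `x` to `y` leaves the
half-plane `0 ≤ · l`, where only steps whose midpoint has a positive `j`-th coordinate are counted.
For a path that avoids the origin, the sum of these numbers tells on which side of the origin it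
leaves the half-plane. -/
noncomputable def crossing (l : Fin 2 → ℝ) (j : Fin 2) (x y : Fin 2 → ℤ) : ℤ :=
  if 0 < x j + y j then halfInd l x - halfInd l y else 0

theorem halfInd_of_nonneg {l : Fin 2 → ℝ} {x : Fin 2 → ℤ} (h : 0 ≤ lev l x) : halfInd l x = 1 :=
  if_pos h

theorem halfInd_of_neg {l : Fin 2 → ℝ} {x : Fin 2 → ℤ} (h : lev l x < 0) : halfInd l x = 0 :=
  if_neg (not_le.2 h)

theorem crossing_of_nonneg {l : Fin 2 → ℝ} {j : Fin 2} {x y : Fin 2 → ℤ} (hx : 0 ≤ lev l x)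
    (hy : 0 ≤ lev l y) : crossing l j x y = 0 := by
  simp [crossing, halfInd_of_nonneg, hx, hy]

theorem crossing_of_neg {l : Fin 2 → ℝ} {j : Fin 2} {x y : Fin 2 → ℤ} (hx : lev l x < 0)
    (hy : lev l y < 0) : crossing l j x y = 0 := by
  simp [crossing, halfInd_of_neg, hx, hy]

theorem lev_eq_of_ne {k j : Fin 2} (hkj : k ≠ j) (l : Fin 2 → ℝ) (x : Fin 2 → ℤ) :
    lev l x = x k * l k + x j * l j := by
  unfold lev
  rw [Fin.sum_univ_two]
  fin_cases k <;> fin_cases j <;> first | exact absurd rfl hkj | simp [add_comm]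

theorem ext_of_ne {k j : Fin 2} (hkj : k ≠ j) {x y : Fin 2 → ℤ} (h1 : x k = y k) (h2 : x j = y j) :
    x = y := by
  ext i
  fin_cases k <;> fin_cases j <;> fin_cases i <;> first | exact absurd rfl hkj | assumption

theorem unitSteps_cases {k j : Fin 2} (hkj : k ≠ j) {e : Fin 2 → ℤ} (he : e ∈ unitSteps 2) :
    (e k = 1 ∧ e j = 0) ∨ (e k = -1 ∧ e j = 0) ∨ (e k = 0 ∧ e j = 1) ∨ (e k = 0 ∧ e j = -1) := by
  obtain ⟨i, hi⟩ := he
  fin_cases k <;> fin_cases j <;> fin_cases i <;> first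
    | exact absurd rfl hkj
    | (rcases hi with rfl | rfl <;> simp)

/-- On the axis `x j = 0` neighbouring sites other than the origin lie in the same half-plane. -/
theorem halfInd_eq_of_axis {k j : Fin 2} (hkj : k ≠ j) {l : Fin 2 → ℝ}
    {x y : Fin 2 → ℤ} (hx : x ≠ 0) (hy : y ≠ 0) (hxj : x j = 0) (hyj : y j = 0)
    (h1 : x k - y k ≤ 1) (h2 : y k - x k ≤ 1) : halfInd l x = halfInd l y := by
  have hxk : x k ≠ 0 := fun h => hx (ext_of_ne hkj h hxj)
  have hyk : y k ≠ 0 := fun h => hy (ext_of_ne hkj h hyj)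
  have key : ∀ z : Fin 2 → ℤ, z j = 0 → lev l z = z k * l k := fun z hz => by
    rw [lev_eq_of_ne hkj, hz]; simp
  have hsign : (0 < x k ∧ 0 < y k) ∨ (x k < 0 ∧ y k < 0) := by omega
  unfold halfInd
  rw [key x hxj, key y hyj]
  congr 1
  refine propext ?_
  rcases hsign with ⟨hx1, hy1⟩ | ⟨hx1, hy1⟩
  · have hx2 : (0 : ℝ) < x k := by exact_mod_cast hx1
    have hy2 : (0 : ℝ) < y k := by exact_mod_cast hy1
    rw [mul_nonneg_iff_of_pos_left hx2, mul_nonneg_iff_of_pos_left hy2]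
  · have hx2 : (x k : ℝ) < 0 := by exact_mod_cast hx1
    have hy2 : (y k : ℝ) < 0 := by exact_mod_cast hy1
    have hx3 : 0 ≤ (x k : ℝ) * l k ↔ l k ≤ 0 :=
      ⟨fun h => by by_contra! h'; nlinarith, fun h => by nlinarith⟩
    have hy3 : 0 ≤ (y k : ℝ) * l k ↔ l k ≤ 0 :=
      ⟨fun h => by by_contra! h'; nlinarith, fun h => by nlinarith⟩
    rw [hx3, hy3]

/-- The crossing numbers form a closed one-form: on a unit square whose corners are not the
origin the two ways from one corner to the opposite one have the same crossing number. -/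
theorem crossing_square {k j : Fin 2} (hkj : k ≠ j) {l : Fin 2 → ℝ}
    {p e f : Fin 2 → ℤ} (he : e ∈ unitSteps 2) (hf : f ∈ unitSteps 2) (h1 : p ≠ 0)
    (h2 : p - e ≠ 0) (h3 : p - e + f ≠ 0) (h4 : p + f ≠ 0) :
    crossing l j p (p - e) + crossing l j (p - e) (p - e + f) =
      crossing l j p (p + f) + crossing l j (p + f) (p - e + f) := by
  have h12 := halfInd_eq_of_axis hkj (l := l) h1 h2
  have h23 := halfInd_eq_of_axis hkj (l := l) h2 h3
  have h14 := halfInd_eq_of_axis hkj (l := l) h1 h4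
  have h43 := halfInd_eq_of_axis hkj (l := l) h4 h3
  have h24 : p - e = p + f ∨ ¬ (e j = -f j ∧ e k = -f k) := by
    by_cases h : e j = -f j ∧ e k = -f k
    · left
      refine ext_of_ne hkj ?_ ?_ <;> simp [h.1, h.2]
    · exact Or.inr h
  have h13 : p = p - e + f ∨ ¬ (e j = f j ∧ e k = f k) := by
    by_cases h : e j = f j ∧ e k = f k
    · left
      refine ext_of_ne hkj ?_ ?_ <;> simp [h.1, h.2]
    · exact Or.inr h
  replace h24 : halfInd l (p - e) = halfInd l (p + f) ∨ ¬ (e j = -f j ∧ e k = -f k) :=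
    h24.imp_left fun h => by rw [h]
  replace h13 : halfInd l p = halfInd l (p - e + f) ∨ ¬ (e j = f j ∧ e k = f k) :=
    h13.imp_left fun h => congrArg _ h
  have hec := unitSteps_cases hkj he
  have hfc := unitSteps_cases hkj hf
  unfold crossing
  simp only [Pi.add_apply, Pi.sub_apply] at h12 h23 h14 h43 ⊢
  generalize halfInd l p = H1 at *
  generalize halfInd l (p - e) = H2 at *
  generalize halfInd l (p - e + f) = H3 at *
  generalize halfInd l (p + f) = H4 at *
  clear h1 h2 h3 h4
  rcases hec with ⟨e1, e2⟩ | ⟨e1, e2⟩ | ⟨e1, e2⟩ | ⟨e1, e2⟩ <;>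
    rcases hfc with ⟨f1, f2⟩ | ⟨f1, f2⟩ | ⟨f1, f2⟩ | ⟨f1, f2⟩ <;>
    split_ifs <;> omega

/-- Summing a closed one-form over a grid gives equality of the two boundary sums. -/
theorem sum_grid_eq {a b : ℕ → ℕ → ℤ} (h : ∀ i j, a i j + b (i + 1) j = b i j + a i (j + 1))
    (n m : ℕ) :
    ∑ i ∈ Finset.range n, a i 0 + ∑ j ∈ Finset.range m, b n j =
      ∑ j ∈ Finset.range m, b 0 j + ∑ i ∈ Finset.range n, a i m := by
  have row : ∀ j, ∑ i ∈ Finset.range n, a i j + b n j =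
      b 0 j + ∑ i ∈ Finset.range n, a i (j + 1) := by
    intro j
    induction n with
    | zero => simp
    | succ n ih =>
      rw [Finset.sum_range_succ, Finset.sum_range_succ]
      linarith [h n j]
  induction m with
  | zero => simp
  | succ m ih =>
    rw [Finset.sum_range_succ, Finset.sum_range_succ]
    linarith [row m]

/-- Two lattice paths that do not meet: the loop described by their difference as the two time
parameters run around a rectangle does not wind around the origin. -/
theorem crossing_sum_eq {k j : Fin 2} (hkj : k ≠ j) {l : Fin 2 → ℝ}
    {X Y : ℕ → Fin 2 → ℤ} (hX : ∀ n, X (n + 1) - X n ∈ unitSteps 2) {M : ℕ}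
    (hY : ∀ n < M, Y (n + 1) - Y n ∈ unitSteps 2) (hXY : ∀ n, ∀ m ≤ M, X n ≠ Y m) (n m : ℕ)
    (hm : m ≤ M) :
    ∑ i ∈ Finset.range n, crossing l j (Y 0 - X i) (Y 0 - X (i + 1)) +
        ∑ i ∈ Finset.range m, crossing l j (Y i - X n) (Y (i + 1) - X n) =
      ∑ i ∈ Finset.range m, crossing l j (Y i - X 0) (Y (i + 1) - X 0) +
        ∑ i ∈ Finset.range n, crossing l j (Y m - X i) (Y m - X (i + 1)) := by
  -- the second path is stopped at time `M`, where both boundary sums stay constant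
  set Y' : ℕ → Fin 2 → ℤ := fun i => Y (min i M) with hY'
  have hne : ∀ i i', Y' i' - X i ≠ 0 := fun i i' h =>
    hXY i _ (min_le_right _ _) (sub_eq_zero.1 h).symm
  have := sum_grid_eq (a := fun i i' => crossing l j (Y' i' - X i) (Y' i' - X (i + 1)))
    (b := fun i i' => crossing l j (Y' i' - X i) (Y' (i' + 1) - X i)) (fun i i' => ?_) n m
  · have h0 : ∀ i ≤ m, Y' i = Y i := fun i hi => by simp [hY', hi.trans hm]
    have hsum : ∀ x, ∑ i ∈ Finset.range m, crossing l j (Y' i - x) (Y' (i + 1) - x) =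
        ∑ i ∈ Finset.range m, crossing l j (Y i - x) (Y (i + 1) - x) := fun x =>
      Finset.sum_congr rfl fun i hi => by
        have := Finset.mem_range.1 hi
        rw [h0 i (by omega), h0 (i + 1) (by omega)]
    simp only [hsum, h0 0 (Nat.zero_le _), h0 m le_rfl] at this
    exact this
  · by_cases hi' : i' < M
    · have h1 : Y' i' - X (i + 1) = Y' i' - X i - (X (i + 1) - X i) := by abel
      have h2 : Y' (i' + 1) - X (i + 1) =
          Y' i' - X i - (X (i + 1) - X i) + (Y (i' + 1) - Y i') := by
        have ha : Y' (i' + 1) = Y (i' + 1) := by simp only [hY']; congr 1; omega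
        have hb : Y' i' = Y i' := by simp only [hY']; congr 1; omega
        rw [ha, hb]; abel
      have h3 : Y' (i' + 1) - X i = Y' i' - X i + (Y (i' + 1) - Y i') := by
        have ha : Y' (i' + 1) = Y (i' + 1) := by simp only [hY']; congr 1; omega
        have hb : Y' i' = Y i' := by simp only [hY']; congr 1; omega
        rw [ha, hb]; abel
      have n1 := hne i i'
      have n2 := hne (i + 1) i'
      have n3 := hne (i + 1) (i' + 1)
      have n4 := hne i (i' + 1)
      rw [h1] at n2 ⊢
      rw [h2] at n3 ⊢
      rw [h3] at n4 ⊢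
      exact crossing_square hkj (hX i) (hY i' hi') n1 n2 n3 n4
    · have : Y' (i' + 1) = Y' i' := by simp only [hY']; congr 1; omega
      have hc : ∀ x, crossing l j x x = 0 := fun x => by simp [crossing]
      simp only [this, hc]
      ring

/-- The trajectories from the origin that never go below their starting level in the direction `l`
and are transient in this direction. -/
def nonbacktracking (l : Fin 2 → ℝ) : Set (ℕ → Fin 2 → ℤ) :=
  {X | X 0 = 0 ∧ (∀ n, X (n + 1) - X n ∈ unitSteps 2) ∧ (∀ n, 0 ≤ lev l (X n)) ∧
    X ∈ transientEvent l}

/-- The trajectories `X` that pass the site `z` on the side where the `j`-th coordinate is smaller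
than that of `z`: seen from the moving point `X n`, the site `z` leaves the half-plane `0 ≤ · l` on
the side where the `j`-th coordinate is positive. -/
def passes (l : Fin 2 → ℝ) (j : Fin 2) (z : Fin 2 → ℤ) : Set (ℕ → Fin 2 → ℤ) :=
  {X | ∀ᶠ n in atTop, 1 ≤ ∑ i ∈ Finset.range n, crossing l j (z - X i) (z - X (i + 1))}

theorem measurableSet_passes (l : Fin 2 → ℝ) (j : Fin 2) (z : Fin 2 → ℤ) :
    MeasurableSet (passes l j z) := by
  have hm : ∀ n, MeasurableSet {X : ℕ → Fin 2 → ℤ |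
      1 ≤ ∑ i ∈ Finset.range n, crossing l j (z - X i) (z - X (i + 1))} := fun n =>
    Det.measurableSet (n := n) fun X Y hY hX => by
      rw [Set.mem_ofPred_eq, Finset.sum_congr rfl fun i hi => by
        rw [hY i (Finset.mem_range.1 hi).le, hY (i + 1) (Finset.mem_range.1 hi)]]
      exact hX
  have : passes l j z = ⋃ N, ⋂ n ≥ N, {X : ℕ → Fin 2 → ℤ |
      1 ≤ ∑ i ∈ Finset.range n, crossing l j (z - X i) (z - X (i + 1))} := by
    ext X
    simp [passes, eventually_atTop]
  rw [this]
  exact MeasurableSet.iUnion fun N => MeasurableSet.iInter fun n => MeasurableSet.iInter fun _ =>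
    hm n

theorem eventually_lev_gt {l : Fin 2 → ℝ} {X : ℕ → Fin 2 → ℤ} (hX : X ∈ nonbacktracking l) (u : ℝ) :
    ∀ᶠ n in atTop, u < lev l (X n) :=
  (mem_transientEvent.1 hX.2.2.2).eventually_gt_atTop u

/-- Two transient trajectories in opposite directions that do not meet pass one another on the same
side: the starting point of each lies on the corresponding side of the other. -/
theorem mem_passes_iff_of_disjoint {k j : Fin 2} (hkj : k ≠ j) {l : Fin 2 → ℝ}
    {X Y : ℕ → Fin 2 → ℤ} {z : Fin 2 → ℤ} (hX : X ∈ nonbacktracking l)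
    (hY : (fun i => Y i - z) ∈ nonbacktracking (-l)) (hXY : ∀ n m, X n ≠ Y m) :
    X ∈ passes l j z ↔
      ∀ᶠ m in atTop, 1 ≤ ∑ i ∈ Finset.range m, crossing l j (Y i) (Y (i + 1)) := by
  have hY0 : Y 0 = z := sub_eq_zero.1 hY.1
  have hYs : ∀ n, Y (n + 1) - Y n ∈ unitSteps 2 := fun n => by simpa using hY.2.1 n
  have hYz : ∀ n, lev l (Y n) ≤ lev l z := fun n => by
    have := hY.2.2.1 n
    rw [lev_neg_left, lev_sub] at this
    linarith
  have hXe := eventually_lev_gt hX (lev l z)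
  have hYe := eventually_lev_gt hY (lev l z)
  have hYe' : ∀ᶠ m in atTop, lev l (Y m) < 0 := by
    filter_upwards [hYe] with m hm
    rw [lev_neg_left, lev_sub] at hm
    linarith
  have key : ∀ᶠ n in atTop, ∀ᶠ m in atTop,
      ∑ i ∈ Finset.range n, crossing l j (z - X i) (z - X (i + 1)) =
        ∑ i ∈ Finset.range m, crossing l j (Y i) (Y (i + 1)) := by
    filter_upwards [hXe] with n hn
    filter_upwards [hYe'] with m hm
    have h := crossing_sum_eq hkj (l := l) hX.2.1 (M := m) (fun n _ => hYs n)
      (fun n m _ => hXY n m) n m le_rfl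
    have h1 : ∑ i ∈ Finset.range m, crossing l j (Y i - X n) (Y (i + 1) - X n) = 0 :=
      Finset.sum_eq_zero fun i _ => crossing_of_neg (by rw [lev_sub]; linarith [hYz i])
        (by rw [lev_sub]; linarith [hYz (i + 1)])
    have h2 : ∑ i ∈ Finset.range n, crossing l j (Y m - X i) (Y m - X (i + 1)) = 0 :=
      Finset.sum_eq_zero fun i _ => crossing_of_neg (by rw [lev_sub]; linarith [hX.2.2.1 i])
        (by rw [lev_sub]; linarith [hX.2.2.1 (i + 1)])
    rw [h1, h2, hX.1, hY0] at h
    simpa using h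
  constructor
  · intro h
    obtain ⟨n, hn1, hn2⟩ := (h.and key).exists
    filter_upwards [hn2] with m hm
    rw [← hm]; exact hn1
  · intro h
    filter_upwards [key] with n hn
    obtain ⟨m, hm1, hm2⟩ := (h.and hn).exists
    rw [hm2]; exact hm1

/-- A trajectory passes neighbouring sites on the same side unless it visits one of them. -/
theorem mem_passes_iff_of_adjacent {k j : Fin 2} (hkj : k ≠ j) {l : Fin 2 → ℝ}
    {X : ℕ → Fin 2 → ℤ} {z z' : Fin 2 → ℤ} (hX : X ∈ nonbacktracking l)
    (hzz' : z' - z ∈ unitSteps 2) (hz : 0 ≤ lev l z) (hz' : 0 ≤ lev l z')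
    (hXz : ∀ n, X n ≠ z) (hXz' : ∀ n, X n ≠ z') : X ∈ passes l j z ↔ X ∈ passes l j z' := by
  refine eventually_congr ?_
  filter_upwards [eventually_lev_gt hX (lev l z), eventually_lev_gt hX (lev l z')] with n hn hn'
  set Y : ℕ → Fin 2 → ℤ := fun i => if i = 0 then z else z' with hYdef
  have h := crossing_sum_eq hkj (l := l) hX.2.1 (Y := Y) (M := 1)
    (fun i hi => by obtain rfl : i = 0 := by omega
                    simpa [hYdef] using hzz')
    (fun n m _ => by simp only [hYdef]; split_ifs; exacts [hXz n, hXz' n]) n 1 le_rfl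
  have h1 : crossing l j (z - X n) (z' - X n) = 0 :=
    crossing_of_neg (by rw [lev_sub]; linarith) (by rw [lev_sub]; linarith)
  have h2 : crossing l j z z' = 0 := crossing_of_nonneg hz hz'
  simp only [Finset.sum_range_one, hYdef, if_true, hX.1, sub_zero, zero_add, one_ne_zero,
    if_false, h1, h2, add_zero] at h
  rw [h]

/-- In a strip `0 ≤ · l ≤ C` the trajectory passes all sites with a sufficiently large `j`-th
coordinate on the side of smaller `j`-th coordinates, and none of those with a sufficiently negative
one. -/
theorem exists_passes_bound {j : Fin 2} {l : Fin 2 → ℝ} {X : ℕ → Fin 2 → ℤ}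
    (hX : X ∈ nonbacktracking l) (C : ℝ) :
    ∃ M : ℤ, ∀ z, 0 ≤ lev l z → lev l z ≤ C →
      (M < z j → X ∈ passes l j z) ∧ (z j < -M → X ∉ passes l j z) := by
  obtain ⟨n₀, hn₀⟩ := eventually_atTop.1 (eventually_lev_gt hX C)
  obtain ⟨M, hM⟩ := ((Set.finite_Iic n₀).image fun i => |X i j|).bddAbove
  have hMi : ∀ i ≤ n₀, |X i j| ≤ M := fun i hi => hM ⟨i, hi, rfl⟩
  refine ⟨M, fun z hz hzC => ?_⟩
  have hsplit : ∀ n ≥ n₀, ∑ i ∈ Finset.range n, crossing l j (z - X i) (z - X (i + 1)) =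
      ∑ i ∈ Finset.range n₀, crossing l j (z - X i) (z - X (i + 1)) := by
    intro n hn
    rw [← Finset.sum_range_add_sum_Ico _ hn, Finset.sum_eq_zero (s := Finset.Ico n₀ n), add_zero]
    intro i hi
    have hi' := (Finset.mem_Ico.1 hi).1
    exact crossing_of_neg (by rw [lev_sub]; linarith [hn₀ i hi'])
      (by rw [lev_sub]; linarith [hn₀ (i + 1) (by omega)])
  constructor
  · intro hzM
    refine eventually_atTop.2 ⟨n₀, fun n hn => ?_⟩
    rw [hsplit n hn]
    have : ∑ i ∈ Finset.range n₀, crossing l j (z - X i) (z - X (i + 1)) =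
        ∑ i ∈ Finset.range n₀, (halfInd l (z - X i) - halfInd l (z - X (i + 1))) := by
      refine Finset.sum_congr rfl fun i hi => if_pos ?_
      have hi' := Finset.mem_range.1 hi
      have h1 := abs_le.1 (hMi i hi'.le)
      have h2 := abs_le.1 (hMi (i + 1) hi')
      simp only [Pi.sub_apply]
      omega
    rw [this, Finset.sum_range_sub', hX.1, sub_zero, halfInd_of_nonneg hz,
      halfInd_of_neg (by rw [lev_sub]; linarith [hn₀ n₀ le_rfl])]
    norm_num
  · intro hzM hpass
    obtain ⟨n, hn1, hn2⟩ := (hpass.and (eventually_ge_atTop n₀)).exists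
    rw [hsplit n hn2, Finset.sum_eq_zero] at hn1
    · omega
    · intro i hi
      have hi' := Finset.mem_range.1 hi
      have h1 := abs_le.1 (hMi i hi'.le)
      have h2 := abs_le.1 (hMi (i + 1) hi')
      refine if_neg ?_
      simp only [Pi.sub_apply]
      omega

end Planar

/-! ### Two walks in a common environment -/

section TwoWalks

variable {d : ℕ}

/-- The annealed law of two walks that start at `0` and at `z` and move independently of one another
in the same environment. -/
noncomputable def jointLaw (μ : Measure (LocalEnv d)) (z : Fin d → ℤ) :
    Measure ((ℕ → Fin d → ℤ) × (ℕ → Fin d → ℤ)) :=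
  (envLaw μ).bind (quenchedKernel 0 ×ₖ quenchedKernel z)

variable {μ : Measure (LocalEnv d)}

theorem jointLaw_apply (z : Fin d → ℤ)
    {E : Set ((ℕ → Fin d → ℤ) × (ℕ → Fin d → ℤ))}
    (hE : MeasurableSet E) :
    jointLaw μ z E = ∫⁻ ω, ((quenchedLaw 0 ω).prod (quenchedLaw z ω)) E ∂envLaw μ := by
  rw [jointLaw, Measure.bind_apply hE (Kernel.measurable _).aemeasurable]
  refine lintegral_congr fun ω => ?_
  rw [Kernel.prod_apply]
  rfl

theorem jointLaw_prod (z : Fin d → ℤ)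
    {s t : Set (ℕ → Fin d → ℤ)} (hs : MeasurableSet s) (ht : MeasurableSet t) :
    jointLaw μ z (s ×ˢ t) = ∫⁻ ω, quenchedLaw 0 ω s * quenchedLaw z ω t ∂envLaw μ := by
  rw [jointLaw_apply z (hs.prod ht)]
  simp_rw [Measure.prod_prod]

theorem jointLaw_prod_univ (z : Fin d → ℤ) {s : Set (ℕ → Fin d → ℤ)} (hs : MeasurableSet s) :
    jointLaw μ z (s ×ˢ Set.univ) = annealedLaw μ 0 s := by
  rw [jointLaw_prod z hs .univ, annealedLaw_apply 0 hs]
  simp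

theorem jointLaw_univ_prod (z : Fin d → ℤ) {t : Set (ℕ → Fin d → ℤ)} (ht : MeasurableSet t) :
    jointLaw μ z (Set.univ ×ˢ t) = annealedLaw μ z t := by
  rw [jointLaw_prod z .univ ht, annealedLaw_apply z ht]
  simp

variable [IsProbabilityMeasure μ]

instance (z : Fin d → ℤ) : IsProbabilityMeasure (jointLaw μ z) := by
  unfold jointLaw; infer_instance

/-- A pair of trajectories, regarded as a trajectory of pairs. -/
def zipPath (p : (ℕ → Fin d → ℤ) × (ℕ → Fin d → ℤ)) : ℕ → (Fin d → ℤ) × (Fin d → ℤ) :=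
  fun n => (p.1 n, p.2 n)

theorem measurable_zipPath : Measurable (zipPath (d := d)) := by
  unfold zipPath; fun_prop

theorem zipPath_preimage_cyl (Z : ℕ → (Fin d → ℤ) × (Fin d → ℤ)) (n : ℕ) :
    zipPath ⁻¹' cyl Z n = cyl (fun i => (Z i).1) n ×ˢ cyl (fun i => (Z i).2) n := by
  ext p
  simp only [Set.mem_preimage, cyl, Set.mem_ofPred_eq, Set.mem_prod, zipPath, Prod.ext_iff]
  exact ⟨fun h => ⟨fun i hi => (h i hi).1, fun i hi => (h i hi).2⟩,
    fun h i hi => ⟨h.1 i hi, h.2 i hi⟩⟩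

/-- The trajectories of pairs whose two components do not meet up to time `n`. -/
def disjointUpTo (n : ℕ) : Set (ℕ → (Fin d → ℤ) × (Fin d → ℤ)) :=
  {Z | ∀ i ≤ n, ∀ j ≤ n, (Z i).1 ≠ (Z j).2}

theorem det_disjointUpTo (n : ℕ) : Det n (disjointUpTo (d := d) n) := fun X Y hY hX i hi j hj => by
  rw [hY i hi, hY j hj]; exact hX i hi j hj

theorem disjointUpTo_anti : Antitone (disjointUpTo (d := d)) := fun _ _ hmn _ hX i hi j hj =>
  hX i (hi.trans hmn) j (hj.trans hmn)

/-- Disjoint pieces of trajectories have the same probability in a common environment as in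
independent environments, because they use different sites. -/
theorem jointLaw_map_zipPath_cyl (z : Fin d → ℤ) {n : ℕ} {Z : ℕ → (Fin d → ℤ) × (Fin d → ℤ)}
    (hZ : Z ∈ disjointUpTo n) :
    (jointLaw μ z).map zipPath (cyl Z n) =
      ((annealedLaw μ 0).prod (annealedLaw μ z)).map zipPath (cyl Z n) := by
  rw [Measure.map_apply measurable_zipPath (measurableSet_cyl Z n),
    Measure.map_apply measurable_zipPath (measurableSet_cyl Z n), zipPath_preimage_cyl,
    jointLaw_prod z (measurableSet_cyl _ n) (measurableSet_cyl _ n), Measure.prod_prod,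
    annealedLaw_apply _ (measurableSet_cyl _ n), annealedLaw_apply _ (measurableSet_cyl _ n)]
  refine lintegral_mul_of_dependsOn (measurable_quenchedLaw_apply _ (measurableSet_cyl _ n))
    (measurable_quenchedLaw_apply _ (measurableSet_cyl _ n)) ?_ (dependsOn_quenchedLaw_cyl _ _ n)
    (dependsOn_quenchedLaw_cyl _ _ n)
  rw [Set.disjoint_left]
  rintro _ ⟨i, hi, rfl⟩ ⟨j, hj, hij⟩
  exact hZ i (Set.mem_Iio.1 hi).le j (Set.mem_Iio.1 hj).le hij.symm

/-- The pairs of trajectories that do not meet. -/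
def disjointPaths : Set ((ℕ → Fin d → ℤ) × (ℕ → Fin d → ℤ)) := {p | ∀ n m, p.1 n ≠ p.2 m}

theorem disjointPaths_eq : disjointPaths (d := d) = zipPath ⁻¹' ⋂ n, disjointUpTo n := by
  ext p
  simp only [disjointPaths, disjointUpTo, zipPath, Set.mem_ofPred_eq, Set.mem_preimage,
    Set.mem_iInter]
  exact ⟨fun h n i _ j _ => h i j,
    fun h i j => h (max i j) i (le_max_left _ _) j (le_max_right _ _)⟩

theorem measurableSet_disjointPaths : MeasurableSet (disjointPaths (d := d)) := by
  rw [disjointPaths_eq]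
  exact measurable_zipPath (MeasurableSet.iInter fun n => (det_disjointUpTo n).measurableSet)

/-- On the event that the two trajectories do not meet, two walks in a common environment cannot be
told apart from two walks in independent environments. -/
theorem jointLaw_inter_disjointPaths (z : Fin d → ℤ)
    {E : Set ((ℕ → Fin d → ℤ) × (ℕ → Fin d → ℤ))} (hE : MeasurableSet E) :
    jointLaw μ z (E ∩ disjointPaths) =
      ((annealedLaw μ 0).prod (annealedLaw μ z)) (E ∩ disjointPaths) := by
  have : IsProbabilityMeasure ((jointLaw μ z).map zipPath) :=
    Measure.isProbabilityMeasure_map measurable_zipPath.aemeasurable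
  have : IsProbabilityMeasure (((annealedLaw μ 0).prod (annealedLaw μ z)).map zipPath) :=
    Measure.isProbabilityMeasure_map measurable_zipPath.aemeasurable
  have key := restrict_iInter_eq_of_cyl (P := (jointLaw μ z).map zipPath)
    (Q := ((annealedLaw μ 0).prod (annealedLaw μ z)).map zipPath) det_disjointUpTo
    disjointUpTo_anti fun n Z hZ => jointLaw_map_zipPath_cyl z hZ
  set ψ : (ℕ → (Fin d → ℤ) × (Fin d → ℤ)) → (ℕ → Fin d → ℤ) × (ℕ → Fin d → ℤ) :=
    fun Z => (fun n => (Z n).1, fun n => (Z n).2) with hψ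
  have hψm : Measurable ψ := by fun_prop
  have hD : MeasurableSet (⋂ n, disjointUpTo (d := d) n) :=
    MeasurableSet.iInter fun n => (det_disjointUpTo n).measurableSet
  have := congrArg (fun R => R (ψ ⁻¹' E)) key
  simp only [Measure.restrict_apply (hψm hE),
    Measure.map_apply measurable_zipPath ((hψm hE).inter hD)] at this
  have hset : zipPath ⁻¹' (ψ ⁻¹' E ∩ ⋂ n, disjointUpTo n) = E ∩ disjointPaths := by
    rw [Set.preimage_inter, ← disjointPaths_eq]
    rfl
  rwa [hset] at this

end TwoWalks

/-! ### Late meetings of two walks -/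

section Meeting

variable {d : ℕ}

/-- The trajectories that are transient in the direction `l` although after time `n` they visit a
site from which the probability of transience is at most `1 - δ`. -/
def lateBad (l : Fin d → ℝ) (δ : ENNReal) (n : ℕ) (ω : Env d) : Set (ℕ → Fin d → ℤ) :=
  {X | X ∈ transientEvent l ∧
    ∃ i ≥ n, quenchedLaw (X i) ω (transientEvent l) ≤ 1 - δ}

theorem quenchedLaw_cyl_inter_transientEvent (x : Fin d → ℤ) (ω : Env d) (l : Fin d → ℝ)
    (X : ℕ → Fin d → ℤ) (n : ℕ) :
    quenchedLaw x ω (cyl X n ∩ transientEvent l) =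
      quenchedLaw (X n) ω (transientEvent l) * quenchedLaw x ω (cyl X n) := by
  rw [mul_comm, ← quenchedLaw_cyl_inter_shift x ω X n (measurableSet_transientEvent l)]
  congr 2
  ext Y
  exact (transientEvent_shift n).symm

theorem det_quenchedLaw_le (ω : Env d) (l : Fin d → ℝ) (c : ENNReal) (n : ℕ) :
    Det n {X : ℕ → Fin d → ℤ | quenchedLaw (X n) ω (transientEvent l) ≤ c} :=
  fun X Y hY hX => by rw [Set.mem_ofPred_eq, hY n le_rfl]; exact hX

/-- The probability that the walk visits a site from which transience has probability at most `δ`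
and is nevertheless transient is at most `δ`. -/
theorem quenchedLaw_low_le (x : Fin d → ℤ) (ω : Env d) (l : Fin d → ℝ) (δ : ENNReal) :
    quenchedLaw x ω {X | X ∈ transientEvent l ∧
      ∃ i, quenchedLaw (X i) ω (transientEvent l) ≤ δ} ≤ δ := by
  have h := measure_inter_exists_le (P := quenchedLaw x ω) (B := transientEvent l) (c := δ)
    (det_quenchedLaw_le ω l δ) fun n X hX => by
      rw [quenchedLaw_cyl_inter_transientEvent]
      gcongr
      exact hX
  refine le_trans (measure_mono ?_) (h.trans ((mul_le_mul_right prob_le_one δ).trans_eq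
    (mul_one δ)))
  rintro X ⟨hX, i, hi⟩
  exact ⟨Set.mem_iUnion.2 ⟨i, hi⟩, hX⟩

theorem measurableSet_lateBad_prod (l : Fin d → ℝ) (δ : ENNReal) (n : ℕ) :
    MeasurableSet {p : Env d × (ℕ → Fin d → ℤ) | p.2 ∈ lateBad l δ n p.1} := by
  have h1 : ∀ i, MeasurableSet {p : Env d × (ℕ → Fin d → ℤ) |
      quenchedLaw (p.2 i) p.1 (transientEvent l) ≤ 1 - δ} := by
    intro i
    have hy : ∀ y, MeasurableSet {ω : Env d | quenchedLaw y ω (transientEvent l) ≤ 1 - δ} :=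
      fun y => measurableSet_le (measurable_quenchedLaw_apply y (measurableSet_transientEvent l))
        measurable_const
    have hset : {p : Env d × (ℕ → Fin d → ℤ) |
        quenchedLaw (p.2 i) p.1 (transientEvent l) ≤ 1 - δ} =
        ⋃ y, {ω : Env d | quenchedLaw y ω (transientEvent l) ≤ 1 - δ} ×ˢ
          {X : ℕ → Fin d → ℤ | X i = y} := by
      ext p
      simp only [Set.mem_iUnion, Set.mem_prod, Set.mem_ofPred_eq]
      constructor
      · intro h
        exact ⟨p.2 i, h, rfl⟩
      · rintro ⟨y, h, rfl⟩
        exact h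
    rw [hset]
    exact MeasurableSet.iUnion fun y => (hy y).prod
      ((by fun_prop : Measurable fun X : ℕ → Fin d → ℤ => X i) (measurableSet_singleton y))
  have h2 : {p : Env d × (ℕ → Fin d → ℤ) | p.2 ∈ lateBad l δ n p.1} =
      Prod.snd ⁻¹' transientEvent l ∩ ⋃ i ≥ n, {p : Env d × (ℕ → Fin d → ℤ) |
        quenchedLaw (p.2 i) p.1 (transientEvent l) ≤ 1 - δ} := by
    ext p
    simp only [lateBad, Set.mem_ofPred_eq, Set.mem_inter_iff, Set.mem_preimage, Set.mem_iUnion,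
      exists_prop]
  rw [h2]
  exact (measurable_snd (measurableSet_transientEvent l)).inter
    (MeasurableSet.iUnion fun i => MeasurableSet.iUnion fun _ => h1 i)

theorem measurableSet_lateBad (l : Fin d → ℝ) (δ : ENNReal) (n : ℕ) (ω : Env d) :
    MeasurableSet (lateBad l δ n ω) :=
  measurable_prodMk_left (x := ω) (measurableSet_lateBad_prod l δ n)

theorem measurable_quenchedLaw_lateBad (x : Fin d → ℤ) (l : Fin d → ℝ) (δ : ENNReal) (n : ℕ) :
    Measurable fun ω : Env d => quenchedLaw x ω (lateBad l δ n ω) := by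
  have h := Kernel.measurable_kernel_prodMk_left (κ := quenchedKernel x)
    (measurableSet_lateBad_prod l δ n)
  have hk : ∀ ω, quenchedKernel x ω = quenchedLaw x ω := fun _ => rfl
  have hs : ∀ ω, Prod.mk ω ⁻¹' {p : Env d × (ℕ → Fin d → ℤ) | p.2 ∈ lateBad l δ n p.1} =
      lateBad l δ n ω := fun _ => rfl
  simp only [hk, hs] at h
  exact h

/-- Lévy's zero-one law: along a transient trajectory the conditional probability of transience
tends to `1`. -/
theorem tendsto_quenchedLaw_lateBad (x : Fin d → ℤ) (ω : Env d) (l : Fin d → ℝ) {δ : ENNReal}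
    (hδ : δ ≠ 0) :
    Tendsto (fun n => quenchedLaw x ω (lateBad l δ n ω)) atTop (nhds 0) := by
  have h0 := measure_inter_frequently_eq_zero (P := quenchedLaw x ω) (B := transientEvent l)
    (c := 1 - δ) (ENNReal.sub_lt_self ENNReal.one_ne_top one_ne_zero hδ)
    (det_quenchedLaw_le ω l (1 - δ)) fun n X hX => by
      rw [quenchedLaw_cyl_inter_transientEvent]
      gcongr
      exact hX
  have hset : (⋂ n, lateBad l δ n ω) ⊆ {X | ∃ᶠ n in atTop,
      X ∈ {X : ℕ → Fin d → ℤ | quenchedLaw (X n) ω (transientEvent l) ≤ 1 - δ}} ∩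
        transientEvent l := by
    intro X hX
    have hX' := Set.mem_iInter.1 hX
    exact ⟨frequently_atTop.2 fun n => (hX' n).2, (hX' 0).1⟩
  have hlim := tendsto_measure_iInter_atTop (μ := quenchedLaw x ω)
    (s := fun n => lateBad l δ n ω) (fun n => (measurableSet_lateBad l δ n ω).nullMeasurableSet)
    (fun m n hmn X hX => ⟨hX.1, by
      obtain ⟨i, hi, h⟩ := hX.2
      exact ⟨i, hmn.trans hi, h⟩⟩) ⟨0, measure_ne_top _ _⟩
  rwa [measure_mono_null hset h0] at hlim

theorem tendsto_lintegral_lateBad (μ : Measure (LocalEnv d)) [IsProbabilityMeasure μ]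
    (l : Fin d → ℝ) {δ : ENNReal} (hδ : δ ≠ 0) :
    Tendsto (fun n => ∫⁻ ω, quenchedLaw 0 ω (lateBad l δ n ω) ∂envLaw μ) atTop (nhds 0) := by
  have := tendsto_lintegral_of_dominated_convergence (μ := envLaw μ)
    (F := fun n ω => quenchedLaw 0 ω (lateBad l δ n ω)) (f := fun _ => 0) (fun _ => 1)
    (fun n => measurable_quenchedLaw_lateBad 0 l δ n) (fun n => ae_of_all _ fun ω => prob_le_one)
    (by simp) (ae_of_all _ fun ω => tendsto_quenchedLaw_lateBad 0 ω l hδ)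
  simpa using this

theorem quenchedLaw_add_transientEvent (x z : Fin d → ℤ) (ω : Env d) (l : Fin d → ℝ) :
    quenchedLaw (x + z) ω (transientEvent l) =
      quenchedLaw x (fun y => ω (y + z)) (transientEvent l) := by
  have hm : Measurable fun (Y : ℕ → Fin d → ℤ) k => Y k + z := by fun_prop
  have hset : (fun (Y : ℕ → Fin d → ℤ) k => Y k + z) ⁻¹' transientEvent l = transientEvent l := by
    ext X
    rw [Set.mem_preimage, transientEvent_add]
  rw [quenchedLaw_add, Measure.map_apply hm (measurableSet_transientEvent l), hset]

theorem lintegral_lateBad_eq (μ : Measure (LocalEnv d)) [IsProbabilityMeasure μ]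
    (l : Fin d → ℝ) (δ : ENNReal) (n : ℕ) (z : Fin d → ℤ) :
    ∫⁻ ω, quenchedLaw z ω (lateBad l δ n ω) ∂envLaw μ =
      ∫⁻ ω, quenchedLaw 0 ω (lateBad l δ n ω) ∂envLaw μ := by
  have hshift : ∀ ω : Env d, quenchedLaw z ω (lateBad l δ n ω) =
      quenchedLaw 0 (fun y => ω (y + z)) (lateBad l δ n fun y => ω (y + z)) := by
    intro ω
    have h := quenchedLaw_add 0 z ω
    rw [zero_add] at h
    have hm : Measurable fun (Y : ℕ → Fin d → ℤ) k => Y k + z := by fun_prop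
    have hset : (fun (Y : ℕ → Fin d → ℤ) k => Y k + z) ⁻¹' lateBad l δ n ω =
        lateBad l δ n fun y => ω (y + z) := by
      ext X
      simp only [lateBad, Set.mem_preimage, Set.mem_ofPred_eq, transientEvent_add,
        quenchedLaw_add_transientEvent]
    rw [h, Measure.map_apply hm (measurableSet_lateBad l δ n ω), hset]
  have key := lintegral_envLaw_shift (μ := μ) z
    (f := fun ω => quenchedLaw 0 ω (lateBad l δ n ω)) (measurable_quenchedLaw_lateBad 0 l δ n)
  simp only [hshift]
  exact key

theorem quenchedLaw_transientEvent_neg_le (x : Fin d → ℤ) (ω : Env d) (l : Fin d → ℝ) :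
    quenchedLaw x ω (transientEvent l) + quenchedLaw x ω (transientEvent (-l)) ≤ 1 := by
  rw [← measure_union _ (measurableSet_transientEvent (-l))]
  · exact prob_le_one
  · rw [Set.disjoint_left]
    intro X hX hX'
    obtain ⟨n, h1, h2⟩ := (((mem_transientEvent.1 hX).eventually_gt_atTop 0).and
      ((mem_transientEvent.1 hX').eventually_gt_atTop 0)).exists
    rw [lev_neg_left] at h2
    linarith

/-- At a site which one walk visits late on its way to infinity in the direction `l`, transience in
the direction `l` is very likely, hence transience in the direction `-l` is very unlikely, and the
other walk would have to overcome this when it visits the same site. -/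
theorem quenchedLaw_prod_meet_le (x z : Fin d → ℤ) (ω : Env d) (l : Fin d → ℝ) {δ : ENNReal}
    (hδ : δ ≠ ⊤) (n : ℕ) :
    ((quenchedLaw x ω).prod (quenchedLaw z ω)) {p | p.1 ∈ transientEvent l ∧
        p.2 ∈ transientEvent (-l) ∧ ∃ i j, (n ≤ i ∨ n ≤ j) ∧ p.1 i = p.2 j} ≤
      quenchedLaw x ω (lateBad l δ n ω) + δ + (quenchedLaw z ω (lateBad (-l) δ n ω) + δ) := by
  set low : (Fin d → ℝ) → Set (ℕ → Fin d → ℤ) := fun l => {X | X ∈ transientEvent l ∧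
      ∃ i, quenchedLaw (X i) ω (transientEvent l) ≤ δ} with hlow
  have hsub : {p : (ℕ → Fin d → ℤ) × (ℕ → Fin d → ℤ) | p.1 ∈ transientEvent l ∧
      p.2 ∈ transientEvent (-l) ∧ ∃ i j, (n ≤ i ∨ n ≤ j) ∧ p.1 i = p.2 j} ⊆
      ((lateBad l δ n ω ×ˢ Set.univ) ∪ (Set.univ ×ˢ low (-l))) ∪
        ((Set.univ ×ˢ lateBad (-l) δ n ω) ∪ (low l ×ˢ Set.univ)) := by
    rintro ⟨X, Y⟩ ⟨hX, hY, i, j, hij, hXY⟩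
    simp only at hX hY hXY
    have hsum := quenchedLaw_transientEvent_neg_le (X i) ω l
    have aux : ∀ a b : ENNReal, a + b ≤ 1 → ¬ a ≤ 1 - δ → b ≤ δ := by
      intro a b hab ha
      have h1 : 1 < a + δ := by
        rw [not_le] at ha
        by_contra! h
        exact absurd (ENNReal.le_sub_of_add_le_right hδ h) (not_le.2 ha)
      have hat : a ≠ ⊤ := ne_top_of_le_ne_top ENNReal.one_ne_top (le_self_add.trans hab)
      exact (ENNReal.add_le_add_iff_left hat).1 (hab.trans h1.le)
    rcases hij with hi | hj
    · left
      by_cases hb : quenchedLaw (X i) ω (transientEvent l) ≤ 1 - δ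
      · exact Or.inl ⟨⟨hX, i, hi, hb⟩, trivial⟩
      · refine Or.inr ⟨trivial, hY, j, ?_⟩
        change quenchedLaw (Y j) ω _ ≤ δ
        rw [← hXY]
        exact aux _ _ hsum hb
    · right
      by_cases hb : quenchedLaw (Y j) ω (transientEvent (-l)) ≤ 1 - δ
      · exact Or.inl ⟨trivial, hY, j, hj, hb⟩
      · rw [← hXY] at hb
        exact Or.inr ⟨⟨hX, i, aux _ _ (by rwa [add_comm]) hb⟩, trivial⟩
  refine (measure_mono hsub).trans ((measure_union_le _ _).trans (add_le_add
    ((measure_union_le _ _).trans (add_le_add ?_ ?_))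
    ((measure_union_le _ _).trans (add_le_add ?_ ?_))))
  · simp [Measure.prod_prod]
  · simpa [Measure.prod_prod] using quenchedLaw_low_le z ω (-l) δ
  · simp [Measure.prod_prod]
  · simpa [Measure.prod_prod] using quenchedLaw_low_le x ω l δ

end Meeting

/-! ### Connectedness of lattice half-planes -/

section HalfPlane

/-- Each line on which the `j`-th coordinate is constant contains a site just inside a given
half-plane. -/
theorem exists_site_lev_mem {k j : Fin 2} (hkj : k ≠ j) {l : Fin 2 → ℝ} (hk : l k ≠ 0) (b : ℤ)
    (R : ℝ) : ∃ z : Fin 2 → ℤ, z j = b ∧ R ≤ lev l z ∧ lev l z ≤ R + |l k| := by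
  obtain ⟨s, hs⟩ : ∃ s : ℤ, (s : ℝ) * l k = |l k| := by
    rcases abs_cases (l k) with ⟨h, _⟩ | ⟨h, _⟩
    · exact ⟨1, by simp [h]⟩
    · exact ⟨-1, by simp [h]⟩
  have hpos : 0 < |l k| := abs_pos.2 hk
  set m : ℤ := ⌈(R - b * l j) / |l k|⌉ with hm
  refine ⟨fun i => if i = k then m * s else b, if_neg hkj.symm, ?_⟩
  have hlev : lev l (fun i => if i = k then m * s else b) = m * |l k| + b * l j := by
    rw [lev_eq_of_ne hkj, if_pos rfl, if_neg hkj.symm, ← hs]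
    push_cast
    ring
  rw [hlev]
  have h1 := Int.le_ceil ((R - b * l j) / |l k|)
  have h2 := (Int.ceil_lt_add_one ((R - b * l j) / |l k|)).le
  rw [← hm] at h1 h2
  rw [div_le_iff₀ hpos] at h1
  rw [← sub_le_iff_le_add, le_div_iff₀ hpos] at h2
  constructor <;> linarith

/-- Half-planes of the lattice are connected: a set of sites that cannot be left by a step inside
the half-plane `R ≤ · l` contains, with a site of this half-plane, all its sites whose `j`-th
coordinate is not smaller. -/
theorem mem_of_forall_step {k j : Fin 2} (hkj : k ≠ j) {l : Fin 2 → ℝ} (hk : l k ≠ 0) {R : ℝ}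
    {S : Set (Fin 2 → ℤ)}
    (hS : ∀ z z', R ≤ lev l z → R ≤ lev l z' → z' - z ∈ unitSteps 2 → z ∈ S → z' ∈ S)
    {z₀ z₁ : Fin 2 → ℤ} (h₀ : R ≤ lev l z₀) (h₁ : R ≤ lev l z₁) (hz₀ : z₀ ∈ S)
    (hj : z₀ j ≤ z₁ j) : z₁ ∈ S := by
  have row : ∀ n : ℕ, ∀ z z' : Fin 2 → ℤ, R ≤ lev l z → R ≤ lev l z' → z' j = z j →
      (z' k - z k).natAbs = n → z ∈ S → z' ∈ S := by
    intro n
    induction n with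
    | zero =>
      intro z z' _ _ hj hn hz
      rwa [ext_of_ne hkj (x := z') (y := z) (by omega) hj]
    | succ n ih =>
      intro z z' hz hz' hj hn hzS
      obtain ⟨s, hs, hs'⟩ : ∃ s : ℤ, (s = 1 ∨ s = -1) ∧ 0 < s * (z k - z' k) := by
        rcases lt_or_gt_of_ne (show z' k ≠ z k by omega) with h | h
        · exact ⟨1, Or.inl rfl, by omega⟩
        · exact ⟨-1, Or.inr rfl, by omega⟩
      set w : Fin 2 → ℤ := z' + Pi.single k s with hw
      have hwk : w k = z' k + s := by simp [hw]
      have hwj : w j = z' j := by simp [hw, hkj.symm]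
      have hwR : R ≤ lev l w := by
        have e1 : lev l w = lev l z' + s * l k := by rw [hw, lev_add, lev_single]
        have e2 : lev l w = lev l z - (z k - z' k - s : ℤ) * l k := by
          rw [lev_eq_of_ne hkj, lev_eq_of_ne hkj, hwk, hwj, hj]
          push_cast
          ring
        by_cases h : 0 ≤ s * l k
        · linarith
        · rw [e2]
          have h3 : 0 ≤ s * (z k - z' k - s) := by rcases hs with rfl | rfl <;> omega
          have h3' : (0 : ℝ) ≤ s * (z k - z' k - s : ℤ) := by exact_mod_cast h3
          have h4 : (z k - z' k - s : ℤ) * l k ≤ 0 := by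
            rcases hs with rfl | rfl <;> push_cast at h h3' ⊢ <;> nlinarith
          linarith
      have hwS : w ∈ S := ih z w hz hwR (hwj.trans hj)
        (by rcases hs with rfl | rfl <;> omega) hzS
      refine hS w z' hwR hz' ⟨k, ?_⟩ hwS
      rcases hs with rfl | rfl
      · right; simp [hw]
      · left; simp [hw, ← Pi.single_neg]
  have rows : ∀ b : ℤ, z₀ j ≤ b → ∀ z, z j = b → R ≤ lev l z → z ∈ S := by
    intro b hb
    induction b, hb using Int.leInduction with
    | base => exact fun z hzj hz => row _ z₀ z h₀ hz hzj rfl hz₀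
    | succ b _ ih =>
      intro z hzj hz
      obtain ⟨w, hwj, hw, -⟩ := exists_site_lev_mem hkj hk b (R + |l j|)
      have hw1 : R ≤ lev l w := by linarith [abs_nonneg (l j)]
      have hw2 : R ≤ lev l (w + Pi.single j 1) := by
        rw [lev_add, lev_single, Int.cast_one]
        linarith [neg_abs_le (l j)]
      refine row _ _ z hw2 hz (by simp [hwj, hzj]) rfl
        (hS w _ hw1 hw2 ⟨j, Or.inl (by simp)⟩ (ih w hwj hw1))
  exact rows _ hj z₁ rfl h₁

end HalfPlane

/-! ### Meetings of two independent walks -/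

section Opposing

/-- The trajectories from `z` that never go above their starting level in the direction `l` and are
transient in the direction `-l`. -/
def opposing (l : Fin 2 → ℝ) (z : Fin 2 → ℤ) : Set (ℕ → Fin 2 → ℤ) :=
  {Y | (fun k => Y k - z) ∈ nonbacktracking (-l)}

theorem measurableSet_nonbacktracking (l : Fin 2 → ℝ) : MeasurableSet (nonbacktracking l) := by
  have h1 : MeasurableSet {X : ℕ → Fin 2 → ℤ | X 0 = 0} :=
    (by fun_prop : Measurable fun X : ℕ → Fin 2 → ℤ => X 0) (measurableSet_singleton 0)
  have h2 : ∀ n, MeasurableSet {X : ℕ → Fin 2 → ℤ | X (n + 1) - X n ∈ unitSteps 2} := fun n =>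
    (by fun_prop : Measurable fun X : ℕ → Fin 2 → ℤ => X (n + 1) - X n)
      (Set.to_countable _).measurableSet
  have h3 : MeasurableSet {X : ℕ → Fin 2 → ℤ | ∀ n, X (n + 1) - X n ∈ unitSteps 2} := by
    rw [Set.ofPred_forall]
    exact MeasurableSet.iInter h2
  exact h1.inter (h3.inter ((measurableSet_forall_lev l 0).inter (measurableSet_transientEvent l)))

theorem measurableSet_opposing (l : Fin 2 → ℝ) (z : Fin 2 → ℤ) :
    MeasurableSet (opposing l z) :=
  (by fun_prop : Measurable fun (Y : ℕ → Fin 2 → ℤ) k => Y k - z)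
    (measurableSet_nonbacktracking (-l))

variable {μ : Measure (LocalEnv 2)}

theorem annealedLaw_nonbacktracking (l : Fin 2 → ℝ) :
    annealedLaw μ 0 (nonbacktracking l) =
      annealedLaw μ 0 {X | (∀ n, 0 ≤ lev l (X n)) ∧ X ∈ transientEvent l} := by
  refine measure_congr ?_
  filter_upwards [ae_annealedLaw_steps (μ := μ) 0] with X hX
  refine propext ?_
  exact ⟨fun h => h.2.2, fun h => ⟨hX.1, hX.2, h⟩⟩

theorem annealedLaw_passes_le_of_adjacent {k j : Fin 2} (hkj : k ≠ j) {l : Fin 2 → ℝ}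
    {z z' : Fin 2 → ℤ} (hzz' : z' - z ∈ unitSteps 2) (hz : 0 ≤ lev l z) (hz' : 0 ≤ lev l z') :
    annealedLaw μ 0 (nonbacktracking l ∩ passes l j z') ≤
      annealedLaw μ 0 (nonbacktracking l ∩ passes l j z) +
        (annealedLaw μ 0 (nonbacktracking l ∩ {X | ∃ n, X n = z}) +
          annealedLaw μ 0 (nonbacktracking l ∩ {X | ∃ n, X n = z'})) := by
  refine le_trans (measure_mono ?_) ((measure_union_le _ _).trans
    (add_le_add_right (measure_union_le _ _) _))
  rintro X ⟨hX, hXp⟩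
  by_cases h1 : ∃ n, X n = z
  · exact Or.inr (Or.inl ⟨hX, h1⟩)
  by_cases h2 : ∃ n, X n = z'
  · exact Or.inr (Or.inr ⟨hX, h2⟩)
  push Not at h1 h2
  exact Or.inl ⟨hX, (mem_passes_iff_of_adjacent hkj hX hzz' hz hz' h1 h2).2 hXp⟩

/-- With high probability, the sites of a strip `0 ≤ · l ≤ C` are passed on the expected side if
their `j`-th coordinate is large in absolute value. -/
theorem exists_lt_annealedLaw_passes {j : Fin 2} (l : Fin 2 → ℝ) (C : ℝ) {c : ENNReal}
    (hc : c < annealedLaw μ 0 (nonbacktracking l)) :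
    ∃ M : ℕ, ∀ z, 0 ≤ lev l z → lev l z ≤ C →
      ((M : ℤ) < z j → c < annealedLaw μ 0 (nonbacktracking l ∩ passes l j z)) ∧
      (z j < -M → c < annealedLaw μ 0 (nonbacktracking l \ passes l j z)) := by
  set N : ℕ → Set (ℕ → Fin 2 → ℤ) := fun M => {X | X ∈ nonbacktracking l ∧
    ∀ z, 0 ≤ lev l z → lev l z ≤ C →
      ((M : ℤ) < z j → X ∈ passes l j z) ∧ (z j < -M → X ∉ passes l j z)} with hN
  have hmono : Monotone N := by
    intro m n hmn X hX
    refine ⟨hX.1, fun z hz hzC => ⟨fun h => (hX.2 z hz hzC).1 (by omega),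
      fun h => (hX.2 z hz hzC).2 (by omega)⟩⟩
  have hU : ⋃ M, N M = nonbacktracking l := by
    refine Set.Subset.antisymm (Set.iUnion_subset fun M X hX => hX.1) fun X hX => ?_
    obtain ⟨M, hM⟩ := exists_passes_bound (j := j) hX C
    refine Set.mem_iUnion.2 ⟨M.toNat, hX, fun z hz hzC => ⟨fun h => (hM z hz hzC).1 (by omega),
      fun h => (hM z hz hzC).2 (by omega)⟩⟩
  have hlim := tendsto_measure_iUnion_atTop (μ := annealedLaw μ 0) hmono
  rw [hU] at hlim
  obtain ⟨M, hM⟩ := (hlim.eventually (lt_mem_nhds hc)).exists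
  refine ⟨M, fun z hz hzC => ⟨fun h => hM.trans_le (measure_mono fun X hX => ?_),
    fun h => hM.trans_le (measure_mono fun X hX => ?_)⟩⟩
  · exact ⟨hX.1, (hX.2 z hz hzC).1 h⟩
  · exact ⟨hX.1, (hX.2 z hz hzC).2 h⟩

variable [IsProbabilityMeasure μ]

theorem annealedLaw_opposing (l : Fin 2 → ℝ) (z : Fin 2 → ℤ) :
    annealedLaw μ z (opposing l z) = annealedLaw μ 0 (nonbacktracking (-l)) :=
  annealedLaw_sub_mem z (measurableSet_nonbacktracking (-l))

/-- Two independent walks meet if the first one visits the starting point of the second one. -/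
theorem mul_le_prod_meet_of_hit (l : Fin 2 → ℝ) (z : Fin 2 → ℤ) :
    annealedLaw μ 0 (nonbacktracking l ∩ {X | ∃ n, X n = z}) *
        annealedLaw μ 0 (nonbacktracking (-l)) ≤
      ((annealedLaw μ 0).prod (annealedLaw μ z))
        ((nonbacktracking l ×ˢ opposing l z) \ disjointPaths) := by
  rw [← annealedLaw_opposing l z, ← Measure.prod_prod]
  refine measure_mono ?_
  rintro ⟨X, Y⟩ ⟨⟨hX, n, hn⟩, hY⟩
  exact ⟨⟨hX, hY⟩, fun h => h n 0 (hn.trans (sub_eq_zero.1 hY.1).symm)⟩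

/-- If it is undecided on which side the first walk passes the site `z`, independence forces two
independent walks to meet, because otherwise both would decide on the same side. -/
theorem mul_le_prod_meet_of_passes {k j : Fin 2} (hkj : k ≠ j) (l : Fin 2 → ℝ) (z : Fin 2 → ℤ)
    {c : ENNReal} (h1 : c ≤ annealedLaw μ 0 (nonbacktracking l ∩ passes l j z))
    (h2 : c ≤ annealedLaw μ 0 (nonbacktracking l \ passes l j z)) :
    c * annealedLaw μ 0 (nonbacktracking (-l)) ≤
      ((annealedLaw μ 0).prod (annealedLaw μ z))
        ((nonbacktracking l ×ˢ opposing l z) \ disjointPaths) := by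
  set H : Set (ℕ → Fin 2 → ℤ) :=
    {Y | ∀ᶠ m in atTop, 1 ≤ ∑ i ∈ Finset.range m, crossing l j (Y i) (Y (i + 1))} with hH
  have hHm : MeasurableSet H := by
    have hs : H = (fun (Y : ℕ → Fin 2 → ℤ) i => -Y i) ⁻¹' passes l j 0 := by
      ext Y
      simp [hH, passes]
    rw [hs]
    exact (by fun_prop : Measurable fun (Y : ℕ → Fin 2 → ℤ) i => -Y i) (measurableSet_passes l j 0)
  have hNm := measurableSet_nonbacktracking l
  have hPm := measurableSet_passes l j z
  have hsub : ((nonbacktracking l ∩ passes l j z) ×ˢ (opposing l z \ H)) ∪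
      ((nonbacktracking l \ passes l j z) ×ˢ (opposing l z ∩ H)) ⊆
      (nonbacktracking l ×ˢ opposing l z) \ disjointPaths := by
    rintro ⟨X, Y⟩ (⟨⟨hX, hXp⟩, hY, hYH⟩ | ⟨⟨hX, hXp⟩, hY, hYH⟩)
    · exact ⟨⟨hX, hY⟩, fun h => hYH ((mem_passes_iff_of_disjoint hkj hX hY h).1 hXp)⟩
    · exact ⟨⟨hX, hY⟩, fun h => hXp ((mem_passes_iff_of_disjoint hkj hX hY h).2 hYH)⟩
  have hdisj : Disjoint ((nonbacktracking l ∩ passes l j z) ×ˢ (opposing l z \ H))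
      ((nonbacktracking l \ passes l j z) ×ˢ (opposing l z ∩ H)) :=
    Set.disjoint_left.2 fun p hp hp' => hp'.1.2 hp.1.2
  refine le_trans ?_ (measure_mono hsub)
  rw [measure_union hdisj ((hNm.diff hPm).prod ((measurableSet_opposing l z).inter hHm)),
    Measure.prod_prod, Measure.prod_prod, ← annealedLaw_opposing l z,
    ← measure_inter_add_sdiff (opposing l z) hHm, mul_add, add_comm]
  gcongr

/-- In independent environments a walk in the direction `l` meets a walk in the direction `-l` with
probability bounded away from zero, provided that the starting point of the latter is chosen
suitably; this may be done at arbitrarily high levels. -/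
theorem exists_mul_le_prod_meet {l : Fin 2 → ℝ} (hl : l ≠ 0)
    (h0 : annealedLaw μ 0 (nonbacktracking l) ≠ 0) {R : ℝ} (hR : 0 ≤ R) :
    ∃ z, R ≤ lev l z ∧
      annealedLaw μ 0 (nonbacktracking l) / 2 / 2 / 2 * annealedLaw μ 0 (nonbacktracking (-l)) ≤
        ((annealedLaw μ 0).prod (annealedLaw μ z))
          ((nonbacktracking l ×ˢ opposing l z) \ disjointPaths) := by
  obtain ⟨k, hk⟩ : ∃ k, l k ≠ 0 := by
    by_contra! h
    exact hl (funext h)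
  obtain ⟨j, hkj⟩ : ∃ j, k ≠ j := ⟨k + 1, by fin_cases k <;> simp⟩
  set p := annealedLaw μ 0 (nonbacktracking l) with hp
  have hpt : p ≠ ⊤ := measure_ne_top _ _
  have hhalf : p / 2 < p := ENNReal.half_lt_self h0 hpt
  have hsplit : ∀ z, annealedLaw μ 0 (nonbacktracking l ∩ passes l j z) +
      annealedLaw μ 0 (nonbacktracking l \ passes l j z) = p := fun z =>
    measure_inter_add_sdiff _ (measurableSet_passes l j z)
  obtain ⟨M, hM⟩ := exists_lt_annealedLaw_passes (μ := μ) (j := j) l (R + |l k|) hhalf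
  obtain ⟨z₀, hz₀j, hz₀, hz₀'⟩ := exists_site_lev_mem hkj hk (-M - 1) R
  obtain ⟨z₁, hz₁j, hz₁, hz₁'⟩ := exists_site_lev_mem hkj hk (M + 1) R
  -- somewhere between the two extremes the majority changes
  obtain ⟨z, z', hz, hz', hzz', hα, hα'⟩ : ∃ z z', R ≤ lev l z ∧ R ≤ lev l z' ∧
      z' - z ∈ unitSteps 2 ∧ annealedLaw μ 0 (nonbacktracking l ∩ passes l j z) ≤ p / 2 ∧
      p / 2 < annealedLaw μ 0 (nonbacktracking l ∩ passes l j z') := by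
    by_contra! hcon
    have h := mem_of_forall_step hkj hk
      (S := {z | annealedLaw μ 0 (nonbacktracking l ∩ passes l j z) ≤ p / 2})
      hcon hz₀ hz₁ ?_ (by omega)
    · exact absurd ((hM z₁ (hR.trans hz₁) hz₁').1 (by omega)) (not_lt.2 h)
    · have h2 := (hM z₀ (hR.trans hz₀) hz₀').2 (by omega)
      by_contra hlt
      have h3 := ENNReal.add_lt_add (not_le.1 hlt) h2
      rw [hsplit, ENNReal.add_halves] at h3
      exact lt_irrefl _ h3
  have h8 : p / 2 / 2 / 2 ≤ p / 2 := ENNReal.half_le_self.trans ENNReal.half_le_self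
  by_cases hmid : p / 2 / 2 / 2 ≤ annealedLaw μ 0 (nonbacktracking l ∩ passes l j z)
  · refine ⟨z, hz, mul_le_prod_meet_of_passes hkj l z hmid (h8.trans ?_)⟩
    by_contra hlt
    have h3 := ENNReal.add_lt_add_of_le_of_lt (measure_ne_top _ _) hα (not_le.1 hlt)
    rw [hsplit, ENNReal.add_halves] at h3
    exact lt_irrefl _ h3
  by_cases h1 : p / 2 / 2 / 2 ≤ annealedLaw μ 0 (nonbacktracking l ∩ {X | ∃ n, X n = z})
  · exact ⟨z, hz, le_trans (by gcongr) (mul_le_prod_meet_of_hit l z)⟩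
  by_cases h2 : p / 2 / 2 / 2 ≤ annealedLaw μ 0 (nonbacktracking l ∩ {X | ∃ n, X n = z'})
  · exact ⟨z', hz', le_trans (by gcongr) (mul_le_prod_meet_of_hit l z')⟩
  exfalso
  have h3 := annealedLaw_passes_le_of_adjacent (μ := μ) hkj hzz' (hR.trans hz) (hR.trans hz')
  have h4 : p / 2 < p / 2 / 2 + (p / 2 / 2 / 2 + p / 2 / 2 / 2) :=
    hα'.trans_le (h3.trans (add_le_add ((not_le.1 hmid).le.trans ENNReal.half_le_self)
      (add_le_add (not_le.1 h1).le (not_le.1 h2).le)))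
  rw [ENNReal.add_halves, ENNReal.add_halves] at h4
  exact lt_irrefl _ h4

end Opposing

/-! ### Walks with distant starting points -/

section Distance

variable {d : ℕ}

theorem abs_lev_le_of_mem_unitSteps (l : Fin d → ℝ) {e : Fin d → ℤ} (he : e ∈ unitSteps d) :
    |lev l e| ≤ ∑ i, |l i| := by
  obtain ⟨i, rfl | rfl⟩ := he
  · rw [lev_single, Int.cast_one, one_mul]
    exact Finset.single_le_sum (f := fun i => |l i|) (fun _ _ => abs_nonneg _) (Finset.mem_univ i)
  · rw [← Pi.single_neg, lev_single, Int.cast_neg, Int.cast_one, neg_one_mul, abs_neg]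
    exact Finset.single_le_sum (f := fun i => |l i|) (fun _ _ => abs_nonneg _) (Finset.mem_univ i)

theorem abs_lev_sub_le (l : Fin d → ℝ) {X : ℕ → Fin d → ℤ}
    (hX : ∀ n, X (n + 1) - X n ∈ unitSteps d) (n : ℕ) :
    |lev l (X n) - lev l (X 0)| ≤ n * ∑ i, |l i| := by
  induction n with
  | zero => simp
  | succ n ih =>
    have h := abs_lev_le_of_mem_unitSteps l (hX n)
    rw [lev_sub] at h
    have h2 := abs_sub_le (lev l (X (n + 1))) (lev l (X n)) (lev l (X 0))
    push_cast
    linarith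

/-- Two walks need a long time to meet if the levels of their starting points are far apart. -/
theorem le_or_le_of_meet {l : Fin d → ℝ} {X Y : ℕ → Fin d → ℤ} {z : Fin d → ℤ} (hX0 : X 0 = 0)
    (hX : ∀ n, X (n + 1) - X n ∈ unitSteps d) (hY0 : Y 0 = z)
    (hY : ∀ n, Y (n + 1) - Y n ∈ unitSteps d) {n i j : ℕ}
    (hz : 2 * n * ∑ i, |l i| < lev l z) (hij : X i = Y j) : n ≤ i ∨ n ≤ j := by
  by_contra! h
  have h1 := (abs_le.1 (abs_lev_sub_le l hX i)).2
  have h2 := (abs_le.1 (abs_lev_sub_le l hY j)).1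
  rw [hX0, lev_zero] at h1
  rw [hY0, ← hij] at h2
  have hK : 0 ≤ ∑ i, |l i| := Finset.sum_nonneg fun _ _ => abs_nonneg _
  have hi : (i : ℝ) * ∑ i, |l i| ≤ n * ∑ i, |l i| :=
    mul_le_mul_of_nonneg_right (by exact_mod_cast h.1.le) hK
  have hj : (j : ℝ) * ∑ i, |l i| ≤ n * ∑ i, |l i| :=
    mul_le_mul_of_nonneg_right (by exact_mod_cast h.2.le) hK
  linarith

end Distance

/-! ### Transience in opposite directions -/

section FarAway

/-- Two walks in a common environment which are transient in opposite directions are unlikely to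
meet if they start far from one another. -/
theorem exists_jointLaw_meet_le (μ : Measure (LocalEnv 2)) [IsProbabilityMeasure μ]
    (l : Fin 2 → ℝ) {ε : ENNReal} (hε : ε ≠ 0) (hε' : ε ≠ ⊤) :
    ∃ R : ℝ, ∀ z, R < lev l z →
      jointLaw μ z ((nonbacktracking l ×ˢ opposing l z) \ disjointPaths) ≤ ε := by
  set δ := ε / 2 / 2 with hδ
  have hδ0 : δ ≠ 0 := by simp [hδ, hε]
  have hδt : δ ≠ ⊤ := ENNReal.div_ne_top (ENNReal.div_ne_top hε' (by simp)) (by simp)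
  obtain ⟨n, hn1, hn2⟩ := (((tendsto_lintegral_lateBad μ l hδ0).eventually
    (ge_mem_nhds (pos_iff_ne_zero.2 hδ0))).and ((tendsto_lintegral_lateBad μ (-l) hδ0).eventually
    (ge_mem_nhds (pos_iff_ne_zero.2 hδ0)))).exists
  refine ⟨2 * n * ∑ i, |l i|, fun z hz => ?_⟩
  rw [jointLaw_apply z (((measurableSet_nonbacktracking l).prod (measurableSet_opposing l z)).diff
    measurableSet_disjointPaths)]
  have hsub : (nonbacktracking l ×ˢ opposing l z) \ disjointPaths ⊆
      {p : (ℕ → Fin 2 → ℤ) × (ℕ → Fin 2 → ℤ) | p.1 ∈ transientEvent l ∧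
        p.2 ∈ transientEvent (-l) ∧ ∃ i j, (n ≤ i ∨ n ≤ j) ∧ p.1 i = p.2 j} := by
    rintro ⟨X, Y⟩ ⟨⟨hX, hY⟩, hXY⟩
    have hmeet : ∃ i j, X i = Y j := by
      by_contra! h
      exact hXY h
    obtain ⟨i, j, hij⟩ := hmeet
    have hYt : Y ∈ transientEvent (-l) := by
      have := (transientEvent_add z).2 hY.2.2.2
      simpa using this
    exact ⟨hX.2.2.2, hYt, i, j, le_or_le_of_meet hX.1 hX.2.1 (sub_eq_zero.1 hY.1)
      (fun m => by simpa using hY.2.1 m) hz hij, hij⟩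
  calc ∫⁻ ω, ((quenchedLaw 0 ω).prod (quenchedLaw z ω))
          ((nonbacktracking l ×ˢ opposing l z) \ disjointPaths) ∂envLaw μ
      ≤ ∫⁻ ω, (quenchedLaw 0 ω (lateBad l δ n ω) + δ +
          (quenchedLaw z ω (lateBad (-l) δ n ω) + δ)) ∂envLaw μ :=
        lintegral_mono fun ω => (measure_mono hsub).trans (quenchedLaw_prod_meet_le 0 z ω l hδt n)
    _ = ∫⁻ ω, quenchedLaw 0 ω (lateBad l δ n ω) ∂envLaw μ + δ +
          (∫⁻ ω, quenchedLaw 0 ω (lateBad (-l) δ n ω) ∂envLaw μ + δ) := by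
        rw [lintegral_add_left ((measurable_quenchedLaw_lateBad 0 l δ n).add_const δ),
          lintegral_add_left (measurable_quenchedLaw_lateBad 0 l δ n),
          lintegral_add_left (measurable_quenchedLaw_lateBad z (-l) δ n),
          lintegral_lateBad_eq μ (-l) δ n z]
        simp
    _ ≤ δ + δ + (δ + δ) := by gcongr
    _ = ε := by rw [hδ, ENNReal.add_halves, ENNReal.add_halves]

variable {μ : Measure (LocalEnv 2)}

theorem ae_prod_steps (z : Fin 2 → ℤ) :
    ∀ᵐ p ∂(annealedLaw μ 0).prod (annealedLaw μ z),
      (p.1 0 = 0 ∧ ∀ n, p.1 (n + 1) - p.1 n ∈ unitSteps 2) ∧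
        (p.2 0 = z ∧ ∀ n, p.2 (n + 1) - p.2 n ∈ unitSteps 2) :=
  (Measure.quasiMeasurePreserving_fst.ae (ae_annealedLaw_steps (μ := μ) 0)).and
    (Measure.quasiMeasurePreserving_snd.ae (ae_annealedLaw_steps (μ := μ) z))

variable [IsProbabilityMeasure μ]

/-- For events that depend on finitely many steps, two walks in a common environment are independent
if they start far from one another. -/
theorem mul_le_jointLaw_of_det {l : Fin 2 → ℝ} {n : ℕ} {K K' : Set (ℕ → Fin 2 → ℤ)}
    (hK : Det n K) (hK' : Det n K') {z : Fin 2 → ℤ} (hz : 2 * (n + 1 : ℕ) * ∑ i, |l i| < lev l z) :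
    annealedLaw μ 0 K * annealedLaw μ 0 K' ≤
      jointLaw μ z (K ×ˢ {Y | (fun k => Y k - z) ∈ K'}) := by
  set K'z : Set (ℕ → Fin 2 → ℤ) := {Y | (fun k => Y k - z) ∈ K'} with hK'z
  set s : Set (ℕ → (Fin 2 → ℤ) × (Fin 2 → ℤ)) :=
    {Z | (fun i => (Z i).1) ∈ K ∧ (fun i => (Z i).2 - z) ∈ K'} ∩ disjointUpTo n with hs
  have hsdet : Det n s := by
    refine Det.inter (fun Z W hW hZ => ⟨?_, ?_⟩) (det_disjointUpTo n)
    · exact hK _ _ (fun i hi => by rw [hW i hi]) hZ.1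
    · exact hK' _ _ (fun i hi => by rw [hW i hi]) hZ.2
  have hsm : MeasurableSet s := hsdet.measurableSet
  have : IsProbabilityMeasure ((jointLaw μ z).map zipPath) :=
    Measure.isProbabilityMeasure_map measurable_zipPath.aemeasurable
  have : IsProbabilityMeasure (((annealedLaw μ 0).prod (annealedLaw μ z)).map zipPath) :=
    Measure.isProbabilityMeasure_map measurable_zipPath.aemeasurable
  have heq := measure_eq_of_cyl (P := (jointLaw μ z).map zipPath)
    (Q := ((annealedLaw μ 0).prod (annealedLaw μ z)).map zipPath) hsdet
    fun Z hZ => jointLaw_map_zipPath_cyl z hZ.2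
  rw [Measure.map_apply measurable_zipPath hsm, Measure.map_apply measurable_zipPath hsm] at heq
  have hsub : zipPath ⁻¹' s ⊆ K ×ˢ K'z := fun p hp => hp.1
  refine le_trans ?_ (measure_mono hsub)
  rw [heq, ← annealedLaw_sub_mem z hK'.measurableSet, ← Measure.prod_prod]
  refine measure_mono_ae ?_
  filter_upwards [ae_prod_steps (μ := μ) z] with p hp hpK
  refine ⟨hpK, fun i hi j hj hij => ?_⟩
  have := le_or_le_of_meet hp.1.1 hp.1.2 hp.2.1 hp.2.2 hz hij
  omega

/-- Two walks in a common environment are asymptotically independent, as their starting points move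
away from one another in the direction `l`, as far as their transience in opposite directions
without backtracking is concerned. -/
theorem exists_mul_le_jointLaw (μ : Measure (LocalEnv 2)) [IsProbabilityMeasure μ]
    (l : Fin 2 → ℝ) {ε : ENNReal} (hε : ε ≠ 0) (hε' : ε ≤ 1) :
    ∃ R : ℝ, ∀ z, R < lev l z →
      annealedLaw μ 0 (nonbacktracking l) * annealedLaw μ 0 (nonbacktracking (-l)) ≤
        jointLaw μ z (nonbacktracking l ×ˢ opposing l z) + 5 * ε := by
  obtain ⟨n, K, hK, hK1, hK2⟩ := exists_det_approx (annealedLaw μ 0)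
    (measurableSet_nonbacktracking l) hε
  obtain ⟨n', K', hK', hK'1, hK'2⟩ := exists_det_approx (annealedLaw μ 0)
    (measurableSet_nonbacktracking (-l)) hε
  refine ⟨2 * (max n n' + 1 : ℕ) * ∑ i, |l i|, fun z hz => ?_⟩
  have hfar := mul_le_jointLaw_of_det (μ := μ) (hK.mono (le_max_left n n'))
    (hK'.mono (le_max_right n n')) hz
  set K'z : Set (ℕ → Fin 2 → ℤ) := {Y | (fun k => Y k - z) ∈ K'} with hK'z
  have hK'm : MeasurableSet K'z :=
    (by fun_prop : Measurable fun (Y : ℕ → Fin 2 → ℤ) k => Y k - z) hK'.measurableSet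
  have hNm := measurableSet_nonbacktracking l
  have hOm := measurableSet_opposing l z
  have hsub : K ×ˢ K'z ⊆ (nonbacktracking l ×ˢ opposing l z) ∪
      (((K \ nonbacktracking l) ×ˢ Set.univ) ∪ (Set.univ ×ˢ (K'z \ opposing l z))) := by
    rintro ⟨X, Y⟩ ⟨hX, hY⟩
    by_cases h1 : X ∈ nonbacktracking l
    · by_cases h2 : Y ∈ opposing l z
      · exact Or.inl ⟨h1, h2⟩
      · exact Or.inr (Or.inr ⟨trivial, hY, h2⟩)
    · exact Or.inr (Or.inl ⟨⟨hX, h1⟩, trivial⟩)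
  have hdiff : annealedLaw μ z (K'z \ opposing l z) ≤ ε :=
    (annealedLaw_sub_mem z (hK'.measurableSet.diff (measurableSet_nonbacktracking (-l)))).trans_le
      hK'1
  have hJ : jointLaw μ z (K ×ˢ K'z) ≤
      jointLaw μ z (nonbacktracking l ×ˢ opposing l z) + (ε + ε) := by
    refine (measure_mono hsub).trans ((measure_union_le _ _).trans
      (add_le_add_right ((measure_union_le _ _).trans ?_) _))
    rw [jointLaw_prod_univ z (hK.measurableSet.diff hNm), jointLaw_univ_prod z (hK'm.diff hOm)]
    exact add_le_add hK1 hdiff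
  have hprod : ∀ a b : ENNReal, a ≤ 1 → b ≤ 1 → (a + ε) * (b + ε) ≤ a * b + 3 * ε := by
    intro a b ha hb
    calc (a + ε) * (b + ε) = a * b + (a * ε + b * ε + ε * ε) := by ring
      _ ≤ a * b + (1 * ε + 1 * ε + 1 * ε) := by gcongr
      _ = a * b + 3 * ε := by ring
  calc annealedLaw μ 0 (nonbacktracking l) * annealedLaw μ 0 (nonbacktracking (-l))
      ≤ (annealedLaw μ 0 K + ε) * (annealedLaw μ 0 K' + ε) := by gcongr
    _ ≤ annealedLaw μ 0 K * annealedLaw μ 0 K' + 3 * ε := hprod _ _ prob_le_one prob_le_one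
    _ ≤ jointLaw μ z (nonbacktracking l ×ˢ opposing l z) + (ε + ε) + 3 * ε := by
        gcongr
        exact hfar.trans hJ
    _ = jointLaw μ z (nonbacktracking l ×ˢ opposing l z) + 5 * ε := by ring

/-- In the plane, transience in two opposite directions cannot have positive probability
simultaneously: otherwise two walks started far apart and running towards one another would meet
with small probability in a common environment, with a probability bounded below in independent
environments, although avoiding one another is equally likely in both situations. -/
theorem annealedLaw_transientEvent_eq_zero_or_neg {l : Fin 2 → ℝ} (hl : l ≠ 0) :
    annealedLaw μ 0 (transientEvent l) = 0 ∨ annealedLaw μ 0 (transientEvent (-l)) = 0 := by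
  by_contra! h
  have hp : annealedLaw μ 0 (nonbacktracking l) ≠ 0 := by
    rw [annealedLaw_nonbacktracking]
    exact annealedLaw_nonbacktracking_ne_zero h.1
  have hq : annealedLaw μ 0 (nonbacktracking (-l)) ≠ 0 := by
    rw [annealedLaw_nonbacktracking]
    exact annealedLaw_nonbacktracking_ne_zero h.2
  set p := annealedLaw μ 0 (nonbacktracking l) with hp_def
  set q := annealedLaw μ 0 (nonbacktracking (-l)) with hq_def
  set c := p / 2 / 2 / 2 * q with hc
  set ε := c / 7 with hε
  have hp1 : p / 2 / 2 / 2 ≤ 1 := ENNReal.half_le_self.trans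
    (ENNReal.half_le_self.trans (ENNReal.half_le_self.trans prob_le_one))
  have hc1 : c ≤ 1 := mul_le_one' hp1 prob_le_one
  have hc0 : c ≠ 0 := by simp [hc, hp, hq]
  have hε0 : ε ≠ 0 := by simp [hε, hc0]
  have hε1 : ε ≤ 1 := ENNReal.div_le_of_le_mul (by simpa using hc1.trans (by norm_num))
  have hεt : ε ≠ ⊤ := ne_top_of_le_ne_top ENNReal.one_ne_top hε1
  have hcε : c = 7 * ε := (ENNReal.mul_div_cancel (by norm_num) (by norm_num)).symm
  obtain ⟨R₁, hR₁⟩ := exists_jointLaw_meet_le μ l hε0 hεt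
  obtain ⟨R₂, hR₂⟩ := exists_mul_le_jointLaw μ l hε0 hε1
  obtain ⟨z, hz, hmeet⟩ := exists_mul_le_prod_meet (μ := μ) hl hp
    (R := max 0 (max R₁ R₂ + 1)) (le_max_left _ _)
  have hz' := (le_max_right _ _).trans hz
  have h1 := hR₁ z (by linarith [le_max_left R₁ R₂])
  have h2 := hR₂ z (by linarith [le_max_right R₁ R₂])
  set E := nonbacktracking l ×ˢ opposing l z with hE
  have hEm : MeasurableSet E :=
    (measurableSet_nonbacktracking l).prod (measurableSet_opposing l z)
  set Q := (annealedLaw μ 0).prod (annealedLaw μ z) with hQ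
  have hQE : Q (E ∩ disjointPaths) + Q (E \ disjointPaths) = p * q := by
    rw [measure_inter_add_sdiff _ measurableSet_disjointPaths, hE, hQ, Measure.prod_prod,
      annealedLaw_opposing]
  rw [← measure_inter_add_sdiff E measurableSet_disjointPaths, jointLaw_inter_disjointPaths z hEm,
    ← hQ, ← hp_def, ← hq_def, ← hQE, add_assoc,
    ENNReal.add_le_add_iff_left (measure_ne_top _ _)] at h2
  have h3 : ε + 6 * ε ≤ 0 + 6 * ε := by
    calc ε + 6 * ε = c := by rw [hcε]; ring
      _ ≤ Q (E \ disjointPaths) := hmeet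
      _ ≤ jointLaw μ z (E \ disjointPaths) + 5 * ε := h2
      _ ≤ ε + 5 * ε := by gcongr
      _ = 0 + 6 * ε := by ring
  have h4 := (ENNReal.add_le_add_iff_right (ENNReal.mul_ne_top (by norm_num) hεt)).1 h3
  exact hε0 (le_antisymm h4 zero_le)

end FarAway

end RWRE

theorem mainTheorem4 (μ : MeasureTheory.Measure (RWRE.LocalEnv 2))
    [MeasureTheory.IsProbabilityMeasure μ] (l : Fin 2 → ℝ) (hl : l ≠ 0) :
    RWRE.annealedLaw μ 0 (RWRE.transientEvent l) = 0 ∨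
      RWRE.annealedLaw μ 0 (RWRE.transientEvent l) = 1 := by
  by_contra! h
  rcases RWRE.annealedLaw_transientEvent_eq_zero_or_neg (μ := μ) hl with h0 | h0
  · exact h.1 h0
  · exact RWRE.annealedLaw_transientEvent_neg_ne_zero h.1 h.2 h0
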